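/- Let $G=(V,A)$ be a finite directed graph (parallel arcs allowed) with root $r\in V$, $n=|V|$, $m=|A|$, in which every arc $e$ has a failure probability $0<p_e<1$. Assume that $G$ is bi-directed (every arc has an anti-parallel twin with the same failure probability) and root-connected (every vertex has a directed path to $r$). Let $p_{\max}=\max_{e\in A}p_e$ (and $p_{\max}=0$ if $A=\emptyset$). For $S\subseteq A$, a cluster of $(V,S)$ is a nonempty set $C\subseteq V\setminus\{r\}$ such that no arc of $S$ leads from $C$ to $V\setminus C$; it is minimal if no proper subset of it is a cluster. The cluster-popping algorithm draws $S\subseteq A$ by including every arc $e$ independently with probability $1-p_e$, and then, as long as $(V,S)$ has a cluster, pops all minimal clusters: all arcs whose source lies in a minimal cluster of $(V,S)$ are redrawn independently (each such $e$ is present with probability $1-p_e$), and all other arcs are kept. Let $T$ be the total number of popped clusters, that is, the sum over all iterations of the number of minimal clusters popped. Then $$\mathbb{E}\,T\le\frac{p_{\max}}{1-p_{\max}}\,mn .$$ Moreover, the algorithm has an explicit implementation (the graph given by adjacency lists, unit-cost array operations, one unit of time per draw of an arc) that carries out exactly the above iterations and stops exactly when there is no cluster, and for which, with an absolute constant in the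 $O(\cdot)$: the initial draw together with the first search for clusters always takes time $O(m+n)$; the expected time spent in the loop (popping, and searching for the minimal clusters of each new subgraph) is $O\big(\frac{p_{\max}}{1-p_{\max}}\,m^2n\big)$; hence the expected total running time is $O\big(m+n+\frac{p_{\max}}{1-p_{\max}}\,m^2n\big)$. -/

import Mathlib

open MeasureTheory ProbabilityTheory
open scoped ENNReal

/-- A finite directed graph with vertex set `Fin n`, arc set `Fin m` and a distinguished root.
The arc `a` goes from `src a` to `tgt a`. -/
structure RootedDigraph (n m : ℕ) where
  src : Fin m → Fin n
  tgt : Fin m → Fin n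
  root : Fin n

/-- A rooted digraph in which every arc `a` has a failure probability `0 < p a < 1`. -/
structure Network (n m : ℕ) extends RootedDigraph n m where
  p : Fin m → ℝ
  p_pos : ∀ a, 0 < p a
  p_lt_one : ∀ a, p a < 1

/-- A cost-counting computation: a value together with the number of elementary steps spent. -/
structure Timed (α : Type) where
  val : α
  time : ℕ

namespace Timed

instance : Monad Timed where
  pure x := ⟨x, 0⟩
  bind x f := ⟨(f x.val).val, x.time + (f x.val).time⟩

/-- One unit of time: it pays for a bounded number of elementary operations (testing whether a list
is empty and splitting off its head, reading or writing one array cell, reading an end of an arc,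
drawing one coin, comparing, branching, adding an element to the front of a list). -/
def tick : Timed Unit := ⟨(), 1⟩

/-- `d` units of time. -/
def ticks (d : ℕ) : Timed Unit := ⟨(), d⟩

end Timed

open Timed

namespace RootedDigraph

variable {n m : ℕ} (G : RootedDigraph n m)

/-- Every vertex has a directed path to the root. -/
def IsRootConnected : Prop :=
  ∀ v, Relation.ReflTransGen (fun u w => ∃ a, G.src a = u ∧ G.tgt a = w) v G.root

/-! ### Clusters

A subgraph is given by `S : Fin m → Bool`, where `S a = true` means that the arc `a` is present. -/

/-- `C` is a cluster of the subgraph `S`: a nonempty set of vertices that does not contain the root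
and that no present arc leaves. -/
def IsCluster (S : Fin m → Bool) (C : Finset (Fin n)) : Prop :=
  C.Nonempty ∧ G.root ∉ C ∧ ∀ a, S a = true → G.src a ∈ C → G.tgt a ∈ C

/-- A cluster none of whose proper subsets is a cluster. -/
def IsMinimalCluster (S : Fin m → Bool) (C : Finset (Fin n)) : Prop :=
  G.IsCluster S C ∧ ∀ C', C' ⊂ C → ¬ G.IsCluster S C'

open Classical in
/-- The set of all minimal clusters of the subgraph `S`. -/
noncomputable def minimalClusters (S : Fin m → Bool) : Finset (Finset (Fin n)) :=
  Finset.univ.filter (G.IsMinimalCluster S)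

/-- One iteration of the loop of cluster popping: every arc whose source lies in a minimal cluster
gets its fresh value, all other arcs keep their value. If there is no cluster, nothing changes. -/
noncomputable def pop (fresh S : Fin m → Bool) : Fin m → Bool := fun a =>
  if G.src a ∈ (G.minimalClusters S).biUnion id then fresh a else S a

/-- The subgraph held by cluster popping after `t` iterations, when `ω (t, a)` is the coin that is
available for the arc `a` at time `t` (time `0` is the initial draw). Once there is no cluster, the
algorithm has stopped and the subgraph is its output. -/
noncomputable def state (ω : ℕ × Fin m → Bool) : ℕ → Fin m → Bool
  | 0 => fun a => ω (0, a)
  | t + 1 => G.pop (fun a => ω (t + 1, a)) (state ω t)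

/-- The total number of clusters popped during the whole execution. -/
noncomputable def poppedClusters (ω : ℕ × Fin m → Bool) : ℝ≥0∞ :=
  ∑' t, ((G.minimalClusters (G.state ω t)).card : ℝ≥0∞)

/-! ### An implementation with a step count

The input graph is stored in adjacency lists. Arrays indexed by vertices or arcs are functions, and
writing to one cell is `Function.update`. -/

/-- The list of arcs that leave `v` (a part of the input). -/
def outArcs (v : Fin n) : List (Fin m) := (List.finRange m).filter (fun a => G.src a = v)

/-- The list of arcs that enter `v` (a part of the input). -/
def inArcs (v : Fin n) : List (Fin m) := (List.finRange m).filter (fun a => G.tgt a = v)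

/-- The arcs followed by a search at `v`: forwards along arcs, or backwards against them. -/
def incident (forward : Bool) (v : Fin n) : List (Fin m) :=
  if forward then G.outArcs v else G.inArcs v

/-- The vertex to which a search proceeds along the arc `a`. -/
def far (forward : Bool) (a : Fin m) : Fin n :=
  if forward then G.tgt a else G.src a

/-- Scans a list of arcs; marks every unmarked vertex that a present arc of the list leads to, and
puts it on the stack. -/
def scan (forward : Bool) (S : Fin m → Bool) :
    List (Fin m) → (Fin n → Bool) → List (Fin n) → Timed ((Fin n → Bool) × List (Fin n))
  | [], mark, stack => do
      tick
      pure (mark, stack)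
  | a :: as, mark, stack => do
      tick
      if S a = true ∧ mark (G.far forward a) = false then
        scan forward S as (Function.update mark (G.far forward a) true) (G.far forward a :: stack)
      else
        scan forward S as mark stack

/-- Graph search until the stack is empty. The first argument is a loop counter; `n` is enough,
since every vertex enters the stack at most once. -/
def search (forward : Bool) (S : Fin m → Bool) :
    ℕ → (Fin n → Bool) → List (Fin n) → Timed (Fin n → Bool)
  | 0, mark, _ => do
      tick
      pure mark
  | _ + 1, mark, [] => do
      tick
      pure mark
  | k + 1, mark, v :: stack => do
      tick
      let r ← G.scan forward S (G.incident forward v) mark stack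
      search forward S k r.1 r.2

/-- Marks `v` and everything that can be reached from it through unmarked vertices. -/
def searchFrom (forward : Bool) (S : Fin m → Bool) (mark : Fin n → Bool) (v : Fin n) :
    Timed (Fin n → Bool) := do
  tick
  G.search forward S n (Function.update mark v true) [v]

/-- Starts a search at every vertex of a list that is still unmarked when its turn comes. Returns
the starting points, the latest one first, and the marks. -/
def sweep (forward : Bool) (S : Fin m → Bool) :
    List (Fin n) → (Fin n → Bool) → List (Fin n) → Timed (List (Fin n) × (Fin n → Bool))
  | [], mark, starts => do
      tick
      pure (starts, mark)
  | v :: vs, mark, starts => do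
      tick
      if mark v = true then
        sweep forward S vs mark starts
      else
        let mark' ← G.searchFrom forward S mark v
        sweep forward S vs mark' (v :: starts)

/-- A new array of `n` unmarked vertices. -/
def newMarks (n : ℕ) : Timed (Fin n → Bool) := do
  ticks n
  pure (fun _ => false)

/-- Cluster detection in linear time: returns one vertex of every minimal cluster, and the array
that marks the union of all minimal clusters. A backward search from the root followed by backward
searches from all vertices not yet marked gives a list of starting points; a backward sweep through
these in reverse order leaves one vertex in every minimal cluster; a forward sweep from those marks
the minimal clusters. -/
def detect (S : Fin m → Bool) : Timed (List (Fin n) × (Fin n → Bool)) := do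
  let mark ← newMarks n
  let mark' ← G.searchFrom false S mark G.root
  let first ← G.sweep false S (List.finRange n) mark' []
  let mark'' ← newMarks n
  let second ← G.sweep false S first.1 mark'' []
  let mark''' ← newMarks n
  let third ← G.sweep true S second.1 mark''' []
  pure (second.1, third.2)

/-- Draws all arcs of a list anew. -/
def redraw (fresh : Fin m → Bool) : List (Fin m) → (Fin m → Bool) → Timed (Fin m → Bool)
  | [], S => do
      tick
      pure S
  | a :: as, S => do
      tick
      redraw fresh as (Function.update S a (fresh a))

/-- Draws all arcs anew that leave a marked vertex of a list. -/
def redrawMarked (fresh : Fin m → Bool) (mark : Fin n → Bool) :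
    List (Fin n) → (Fin m → Bool) → Timed (Fin m → Bool)
  | [], S => do
      tick
      pure S
  | v :: vs, S => do
      tick
      if mark v = true then
        let S' ← redraw fresh (G.outArcs v) S
        redrawMarked fresh mark vs S'
      else
        redrawMarked fresh mark vs S

/-- A configuration of the implementation at the head of its loop. -/
structure Config (n m : ℕ) where
  /-- the present subgraph -/
  graph : Fin m → Bool
  /-- one vertex of each minimal cluster; the loop stops if this list is empty -/
  reps : List (Fin n)
  /-- marks the vertices in minimal clusters -/
  inCluster : Fin n → Bool

/-- The execution of cluster popping, cut off after at most `k` iterations of its loop. The initial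
draw and the first cluster detection come before the loop; an iteration redraws the arcs that leave
the minimal clusters and detects the minimal clusters of the new subgraph. -/
def run (ω : ℕ × Fin m → Bool) : ℕ → Timed (Config n m)
  | 0 => do
      let S ← redraw (fun a => ω (0, a)) (List.finRange m) (fun _ => false)
      let d ← G.detect S
      pure ⟨S, d.1, d.2⟩
  | k + 1 => do
      let c ← run ω k
      if c.reps = [] then
        pure c
      else
        tick
        let S ← G.redrawMarked (fun a => ω (k + 1, a)) c.inCluster (List.finRange n) c.graph
        let d ← G.detect S
        pure ⟨S, d.1, d.2⟩

/-- The running time of the whole execution (infinite if it does not stop). -/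
noncomputable def runningTime (ω : ℕ × Fin m → Bool) : ℝ≥0∞ := ⨆ k, ((G.run ω k).time : ℝ≥0∞)

/-- The time spent before the loop: the initial draw and the first cluster detection. -/
def initialTime (ω : ℕ × Fin m → Bool) : ℕ := (G.run ω 0).time

/-- The time spent in the loop. -/
noncomputable def poppingTime (ω : ℕ × Fin m → Bool) : ℝ≥0∞ :=
  G.runningTime ω - (G.initialTime ω : ℝ≥0∞)

end RootedDigraph

namespace Network

variable {n m : ℕ} (N : Network n m)

/-- Every arc has an anti-parallel twin with the same failure probability. Parallel arcs are
allowed, therefore the twins are given by an involution of the arcs. -/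
def IsBidirected : Prop :=
  ∃ rev : Fin m → Fin m, Function.Involutive rev ∧
    ∀ a, N.src (rev a) = N.tgt a ∧ N.tgt (rev a) = N.src a ∧ N.p (rev a) = N.p a

/-- The largest failure probability (`0` if there are no arcs). -/
noncomputable def pMax : ℝ := ⨆ a, N.p a

/-- The law of one coin for the arc `a`: `false` (the arc fails) with probability `p a`, and `true`
with probability `1 - p a`. -/
noncomputable def coin (a : Fin m) : Measure Bool :=
  bernoulliMeasure false true ⟨N.p a, (N.p_pos a).le, (N.p_lt_one a).le⟩

instance (a : Fin m) : IsProbabilityMeasure (N.coin a) := by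
  unfold coin
  infer_instance

/-- The law of the coins used by cluster popping: independent over all times and arcs. -/
noncomputable def coins : Measure (ℕ × Fin m → Bool) :=
  Measure.infinitePi (fun x : ℕ × Fin m => N.coin x.2)

instance : IsProbabilityMeasure N.coins := by
  unfold coins
  infer_instance

end Network

/-!
The expected number of popped clusters is at most `q₁ / q₀`, where `q₁` and `q₀` are the
probabilities that the initial subgraph has exactly one minimal cluster and none, respectively;
and `q₁ / q₀` is bounded by an injection.

Minimal clusters of one subgraph are pairwise disjoint, and whether `C` is a minimal cluster
depends only on the arcs that leave vertices of `C`. Hence the event that `I` is the set of all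
minimal clusters is the intersection of an event about the arcs that leave `⋃ I` and an event
about the other arcs, and popping redraws exactly the former arcs (`sum_sum_resample`). So the law
of the subgraph after `t` iterations has a density `d t` that depends only on its set `M` of
minimal clusters (`coins_state`). With `A t` the expectation of the sum of `d t (M \ {C})` over `C
∈ M` under the initial law, and `B t` the expected number of clusters popped at time `t`, one has
`A 0 = B 0` and `A (t + 1) = A t + B (t + 1)` (`erasedDensity_succ`). Thus the partial sums of `B`
are the values of `A`. These are bounded, so `B` tends to zero, and with it `d t J` for every
family `J ≠ ∅` that can occur. In the limit only the subgraphs with a single minimal cluster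
contribute to `A`, with the factor `d t ∅ ≤ 1 / q₀` (`sum_expPopped_le`).

A subgraph with exactly one minimal cluster is made root-connected by adding an arc from a vertex
`u` that does not reach the root to a vertex that does, and reversing all arcs between different
strongly connected components among the vertices that `u` reaches. Reversing such arcs reverses
reachability there (`reach_reverse_iff`), so the step can be undone from the new subgraph, the
added arc and a vertex of the cluster (`exists_repair`). The twins have equal failure
probabilities, so only the added arc changes the weight; this gives `q₁ ≤ p_max / (1 - p_max) * m
* n * q₀` (`oneClusterProb_le`).

In the implementation, the first backward sweep lists starting points none of which reaches an
earlier one; those which the second sweep keeps do not reach a later one either, and hence lie one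
in each minimal cluster (`detect_reps`). Each detection takes linear time, since every vertex pays
for its own turn on the stack (`time_search`). Each iteration pops at least one cluster, and a
root-connected graph has at most `m + 1` vertices, so the running time follows from the bound on
the number of popped clusters.
-/

/-! ### Reachability and minimal clusters -/

namespace RootedDigraph

variable {n m : ℕ} {G : RootedDigraph n m} {S S' : Fin m → Bool} {C C' : Finset (Fin n)}
  {u v w : Fin n}

/-- A directed path from `u` to `w` in the subgraph `S`. -/
def Reach (G : RootedDigraph n m) (S : Fin m → Bool) : Fin n → Fin n → Prop :=
  Relation.ReflTransGen (fun u w => ∃ a, S a = true ∧ G.src a = u ∧ G.tgt a = w)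

theorem Reach.refl (v : Fin n) : G.Reach S v v := Relation.ReflTransGen.refl

theorem Reach.trans (h : G.Reach S u v) (h' : G.Reach S v w) : G.Reach S u w :=
  Relation.ReflTransGen.trans h h'

theorem Reach.of_arc {a : Fin m} (ha : S a = true) : G.Reach S (G.src a) (G.tgt a) :=
  Relation.ReflTransGen.single ⟨a, ha, rfl, rfl⟩

theorem Reach.mono (hS : ∀ a, S a = true → S' a = true) (h : G.Reach S u v) :
    G.Reach S' u v := by
  induction h with
  | refl => exact Reach.refl u
  | tail _ hs ih =>
    obtain ⟨a, ha, rfl, rfl⟩ := hs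
    exact ih.trans (Reach.of_arc (hS a ha))

theorem IsCluster.mem_of_reach (hC : G.IsCluster S C) (hv : v ∈ C) (h : G.Reach S v w) :
    w ∈ C := by
  induction h with
  | refl => exact hv
  | tail _ hs ih =>
    obtain ⟨a, ha, rfl, rfl⟩ := hs
    exact hC.2.2 a ha ih

theorem IsCluster.not_reach_root (hC : G.IsCluster S C) (hv : v ∈ C) :
    ¬ G.Reach S v G.root :=
  fun h => hC.2.1 (hC.mem_of_reach hv h)

open Classical in
theorem isCluster_filter_reach (h : ¬ G.Reach S v G.root) :
    G.IsCluster S (Finset.univ.filter (G.Reach S v)) := by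
  refine ⟨⟨v, by simpa using Reach.refl v⟩, by simpa using h, fun a ha hs => ?_⟩
  simp only [Finset.mem_filter, Finset.mem_univ, true_and] at hs ⊢
  exact hs.trans (Reach.of_arc ha)

theorem IsCluster.exists_minimal (hC : G.IsCluster S C) :
    ∃ C', C' ⊆ C ∧ G.IsMinimalCluster S C' := by
  induction C using Finset.strongInduction with
  | H C ih =>
    by_cases h : G.IsMinimalCluster S C
    · exact ⟨C, subset_rfl, h⟩
    · simp only [IsMinimalCluster, not_and, not_forall, not_not] at h
      obtain ⟨C', hC', hcl⟩ := h hC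
      obtain ⟨C'', hsub, hmin⟩ := ih C' hC' hcl
      exact ⟨C'', hsub.trans hC'.1, hmin⟩

theorem IsMinimalCluster.eq_of_subset (hC : G.IsMinimalCluster S C) (hC' : G.IsCluster S C')
    (h : C' ⊆ C) : C' = C := by
  by_contra hne
  exact hC.2 C' (Finset.ssubset_iff_subset_ne.2 ⟨h, hne⟩) hC'

theorem IsMinimalCluster.reach (hC : G.IsMinimalCluster S C) (hv : v ∈ C) (hw : w ∈ C) :
    G.Reach S v w := by
  classical
  have hcl := isCluster_filter_reach (hC.1.not_reach_root hv)
  have := hC.eq_of_subset hcl fun x hx => hC.1.mem_of_reach hv (by simpa using hx)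
  rw [← this] at hw
  simpa using hw

theorem IsMinimalCluster.disjoint (hC : G.IsMinimalCluster S C) (hC' : G.IsMinimalCluster S C')
    (hne : C ≠ C') : Disjoint C C' := by
  rw [Finset.disjoint_iff_inter_eq_empty]
  by_contra h
  have hcl : G.IsCluster S (C ∩ C') := by
    refine ⟨Finset.nonempty_iff_ne_empty.2 h, fun hr => hC.1.2.1 (Finset.mem_inter.1 hr).1, ?_⟩
    intro a ha hs
    rw [Finset.mem_inter] at hs ⊢
    exact ⟨hC.1.2.2 a ha hs.1, hC'.1.2.2 a ha hs.2⟩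
  exact hne ((hC.eq_of_subset hcl Finset.inter_subset_left).symm.trans
    (hC'.eq_of_subset hcl Finset.inter_subset_right))

theorem IsCluster.congr (h : ∀ a, G.src a ∈ C → S a = S' a) (hC : G.IsCluster S C) :
    G.IsCluster S' C :=
  ⟨hC.1, hC.2.1, fun a ha hs => hC.2.2 a ((h a hs).trans ha) hs⟩

/-- Being a minimal cluster depends only on the arcs that leave a vertex of the set. -/
theorem isMinimalCluster_congr (h : ∀ a, G.src a ∈ C → S a = S' a) :
    G.IsMinimalCluster S C ↔ G.IsMinimalCluster S' C := by
  constructor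
  · exact fun hC => ⟨hC.1.congr h, fun C' hlt hC' =>
      hC.2 C' hlt (hC'.congr fun a ha => (h a (hlt.1 ha)).symm)⟩
  · exact fun hC => ⟨hC.1.congr fun a ha => (h a ha).symm, fun C' hlt hC' =>
      hC.2 C' hlt (hC'.congr fun a ha => h a (hlt.1 ha))⟩

theorem mem_minimalClusters : C ∈ G.minimalClusters S ↔ G.IsMinimalCluster S C := by
  simp [minimalClusters]

theorem minimalClusters_eq_empty_iff :
    G.minimalClusters S = ∅ ↔ ¬ ∃ C, G.IsCluster S C := by
  rw [Finset.eq_empty_iff_forall_notMem]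
  constructor
  · rintro h ⟨C, hC⟩
    obtain ⟨C', -, hmin⟩ := hC.exists_minimal
    exact h C' (mem_minimalClusters.2 hmin)
  · exact fun h C hC => h ⟨C, (mem_minimalClusters.1 hC).1⟩

/-- A vertex that does not reach the root reaches some minimal cluster. -/
theorem exists_minimal_of_not_reach (h : ¬ G.Reach S v G.root) :
    ∃ C, G.IsMinimalCluster S C ∧ ∀ w ∈ C, G.Reach S v w := by
  classical
  obtain ⟨C, hsub, hC⟩ := (isCluster_filter_reach h).exists_minimal
  exact ⟨C, hC, fun w hw => by simpa using hsub hw⟩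

theorem minimalClusters_eq_empty_iff_reach :
    G.minimalClusters S = ∅ ↔ ∀ v, G.Reach S v G.root := by
  constructor
  · intro h v
    by_contra hv
    obtain ⟨C, hC, -⟩ := exists_minimal_of_not_reach hv
    exact Finset.notMem_empty C (h ▸ mem_minimalClusters.2 hC)
  · intro h
    rw [minimalClusters_eq_empty_iff]
    rintro ⟨C, hC⟩
    obtain ⟨v, hv⟩ := hC.1
    exact hC.not_reach_root hv (h v)

end RootedDigraph

/-! ### Graph search -/

namespace RootedDigraph

variable {n m : ℕ} {G : RootedDigraph n m} {S : Fin m → Bool}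

/-- The end of an arc from which a search in the given direction starts. -/
def near (G : RootedDigraph n m) (forward : Bool) (a : Fin m) : Fin n :=
  if forward then G.src a else G.tgt a

/-- Reachability in the direction of a search: along the arcs, or against them. -/
def Follow (G : RootedDigraph n m) (forward : Bool) (S : Fin m → Bool) : Fin n → Fin n → Prop :=
  Relation.ReflTransGen (fun u w => ∃ a, S a = true ∧ G.near forward a = u ∧ G.far forward a = w)

theorem follow_true (u w : Fin n) : G.Follow true S u w ↔ G.Reach S u w := Iff.rfl

theorem follow_false (u w : Fin n) : G.Follow false S u w ↔ G.Reach S w u := by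
  unfold Follow Reach
  rw [← Relation.reflTransGen_swap]
  have : (fun u w => ∃ a, S a = true ∧ G.near false a = u ∧ G.far false a = w) =
      Function.swap (fun u w => ∃ a, S a = true ∧ G.src a = u ∧ G.tgt a = w) := by
    funext u w
    simp only [near, far, Function.swap, eq_iff_iff]
    constructor <;> rintro ⟨a, h, h1, h2⟩ <;> exact ⟨a, h, h2, h1⟩
  rw [this]

theorem mem_incident {fwd : Bool} {v : Fin n} {a : Fin m} :
    a ∈ G.incident fwd v ↔ G.near fwd a = v := by
  cases fwd <;> simp [incident, near, outArcs, inArcs]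

/-- A set of marks is closed if the search cannot leave it. -/
def ClosedMarks (G : RootedDigraph n m) (fwd : Bool) (S : Fin m → Bool) (mark : Fin n → Bool) :
    Prop :=
  ∀ a, S a = true → mark (G.near fwd a) = true → mark (G.far fwd a) = true

theorem ClosedMarks.follow {fwd : Bool} {mark : Fin n → Bool} {v w : Fin n}
    (h : G.ClosedMarks fwd S mark) (hv : mark v = true) (hw : G.Follow fwd S v w) :
    mark w = true := by
  induction hw with
  | refl => exact hv
  | tail _ hs ih =>
    obtain ⟨a, ha, rfl, rfl⟩ := hs
    exact h a ha ih

/-- The vertices that a search has still to process, unmarked or on the stack, weighted by `f`. -/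
def pending (f : Fin n → ℕ) (mark : Fin n → Bool) (stack : List (Fin n)) : ℕ :=
  (∑ w, if mark w = true then 0 else f w) + (stack.map f).sum

theorem pending_push (f : Fin n → ℕ) {mark : Fin n → Bool} {stack : List (Fin n)} {v : Fin n}
    (h : mark v = false) :
    pending f (Function.update mark v true) (v :: stack) = pending f mark stack := by
  have h1 : (∑ w, if mark w = true then 0 else f w)
      = f v + ∑ w, if Function.update mark v true w = true then 0 else f w := by
    rw [← Finset.add_sum_erase _ _ (Finset.mem_univ v),
      ← Finset.add_sum_erase (a := v) _ (fun w => if Function.update mark v true w = true then 0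
        else f w) (Finset.mem_univ v)]
    simp only [h, Function.update_self, if_true, zero_add, Bool.false_eq_true, if_false]
    congr 1
    refine Finset.sum_congr rfl fun w hw => ?_
    rw [Function.update_of_ne (Finset.ne_of_mem_erase hw)]
  simp only [pending, List.map_cons, List.sum_cons, h1]
  ring

theorem scan_cons (fwd : Bool) (S : Fin m → Bool) (a : Fin m) (as : List (Fin m))
    (mark : Fin n → Bool) (stack : List (Fin n)) :
    G.scan fwd S (a :: as) mark stack =
      if S a = true ∧ mark (G.far fwd a) = false then
        ⟨(G.scan fwd S as (Function.update mark (G.far fwd a) true) (G.far fwd a :: stack)).val,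
          1 + (G.scan fwd S as (Function.update mark (G.far fwd a) true)
            (G.far fwd a :: stack)).time⟩
      else ⟨(G.scan fwd S as mark stack).val, 1 + (G.scan fwd S as mark stack).time⟩ := by
  rw [scan]
  split_ifs <;> rfl

theorem time_scan (fwd : Bool) (as : List (Fin m)) (mark : Fin n → Bool)
    (stack : List (Fin n)) : (G.scan fwd S as mark stack).time = as.length + 1 := by
  induction as generalizing mark stack with
  | nil => rfl
  | cons a as ih =>
    rw [scan_cons]
    split_ifs <;> simp only [ih, List.length_cons] <;> ring

theorem pending_scan (f : Fin n → ℕ) (fwd : Bool) (as : List (Fin m)) (mark : Fin n → Bool)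
    (stack : List (Fin n)) :
    pending f (G.scan fwd S as mark stack).val.1 (G.scan fwd S as mark stack).val.2
      = pending f mark stack := by
  induction as generalizing mark stack with
  | nil => rfl
  | cons a as ih =>
    rw [scan_cons]
    split_ifs with h
    · exact (ih _ _).trans (pending_push f h.2)
    · exact ih _ _

/-- A scan keeps the marks and the stack, marks the present arcs' far ends, and whatever it marks
newly lies on the stack and is the far end of a scanned present arc. -/
theorem scan_spec (fwd : Bool) (as : List (Fin m)) (mark : Fin n → Bool) (stack : List (Fin n)) :
    (∀ w, mark w = true → (G.scan fwd S as mark stack).val.1 w = true) ∧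
    (∀ w ∈ stack, w ∈ (G.scan fwd S as mark stack).val.2) ∧
    (∀ a ∈ as, S a = true → (G.scan fwd S as mark stack).val.1 (G.far fwd a) = true) ∧
    (∀ w, (G.scan fwd S as mark stack).val.1 w = true → mark w = true ∨
      w ∈ (G.scan fwd S as mark stack).val.2 ∧ ∃ a ∈ as, S a = true ∧ G.far fwd a = w) ∧
    (∀ w ∈ (G.scan fwd S as mark stack).val.2, w ∈ stack ∨
      (G.scan fwd S as mark stack).val.1 w = true) := by
  induction as generalizing mark stack with
  | nil =>
    refine ⟨fun w h => h, fun w h => h, by simp, fun w h => Or.inl h, fun w h => Or.inl h⟩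
  | cons a as ih =>
    rw [scan_cons]
    split_ifs with h
    · obtain ⟨h1, h2, h3, h4, h5⟩ :=
        ih (Function.update mark (G.far fwd a) true) (G.far fwd a :: stack)
      refine ⟨fun w hw => h1 w ?_, fun w hw => h2 w (List.mem_cons_of_mem _ hw), ?_, ?_, ?_⟩
      · by_cases hwa : w = G.far fwd a
        · simp [hwa]
        · simpa [Function.update_of_ne hwa] using hw
      · intro b hb hSb
        rcases List.mem_cons.1 hb with rfl | hb
        · exact h1 _ (by simp)
        · exact h3 b hb hSb
      · intro w hw
        by_cases hwa : w = G.far fwd a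
        · exact Or.inr ⟨h2 w (by simp [hwa]), a, by simp, h.1, hwa.symm⟩
        · rcases h4 w hw with h' | ⟨h', b, hb, hSb⟩
          · exact Or.inl (by simpa [Function.update_of_ne hwa] using h')
          · exact Or.inr ⟨h', b, List.mem_cons_of_mem _ hb, hSb⟩
      · intro w hw
        rcases h5 w hw with h' | h'
        · rcases List.mem_cons.1 h' with rfl | h'
          · exact Or.inr (h1 _ (by simp))
          · exact Or.inl h'
        · exact Or.inr h'
    · obtain ⟨h1, h2, h3, h4, h5⟩ := ih mark stack
      refine ⟨h1, h2, ?_, ?_, h5⟩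
      · intro b hb hSb
        rcases List.mem_cons.1 hb with rfl | hb
        · exact h1 _ (by simpa [hSb] using h)
        · exact h3 b hb hSb
      · intro w hw
        rcases h4 w hw with h' | ⟨h', b, hb, hSb⟩
        · exact Or.inl h'
        · exact Or.inr ⟨h', b, List.mem_cons_of_mem _ hb, hSb⟩

theorem search_cons (fwd : Bool) (S : Fin m → Bool) (k : ℕ) (mark : Fin n → Bool) (v : Fin n)
    (stack : List (Fin n)) :
    G.search fwd S (k + 1) mark (v :: stack) =
      ⟨(G.search fwd S k (G.scan fwd S (G.incident fwd v) mark stack).val.1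
          (G.scan fwd S (G.incident fwd v) mark stack).val.2).val,
        1 + ((G.scan fwd S (G.incident fwd v) mark stack).time +
        (G.search fwd S k (G.scan fwd S (G.incident fwd v) mark stack).val.1
          (G.scan fwd S (G.incident fwd v) mark stack).val.2).time)⟩ := rfl

/-- If every marked vertex that is not on the stack has all its successors marked, then a search
with a large enough loop counter marks exactly what can be reached from the marked vertices. -/
theorem search_spec (fwd : Bool) (k : ℕ) (mark : Fin n → Bool) (stack : List (Fin n))
    (hk : pending (fun _ => 1) mark stack ≤ k) (hstack : ∀ w ∈ stack, mark w = true)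
    (hclosed : ∀ a, S a = true → mark (G.near fwd a) = true → G.near fwd a ∉ stack →
      mark (G.far fwd a) = true) :
    (∀ w, (G.search fwd S k mark stack).val w = true ↔
      ∃ v, mark v = true ∧ G.Follow fwd S v w) := by
  have key : ∀ mark : Fin n → Bool, (∀ a, S a = true → mark (G.near fwd a) = true →
      mark (G.far fwd a) = true) → ∀ w, mark w = true ↔ ∃ v, mark v = true ∧ G.Follow fwd S v w :=
    fun mark h w => ⟨fun hw => ⟨w, hw, Relation.ReflTransGen.refl⟩,
      fun ⟨v, hv, hvw⟩ => ClosedMarks.follow h hv hvw⟩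
  induction k generalizing mark stack with
  | zero =>
    have : stack = [] := by
      cases stack with
      | nil => rfl
      | cons v stack => simp [pending] at hk
    subst this
    exact key mark (by simpa using hclosed)
  | succ k ih =>
    cases stack with
    | nil => exact key mark (by simpa using hclosed)
    | cons v stack =>
      rw [search_cons]
      obtain ⟨h1, h2, h3, h4, h5⟩ := scan_spec (G := G) (S := S) fwd (G.incident fwd v) mark stack
      intro w
      rw [ih]
      · constructor
        · rintro ⟨x, hx, hxw⟩
          rcases h4 x hx with h | ⟨-, a, ha, hSa, rfl⟩
          · exact ⟨x, h, hxw⟩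
          · exact ⟨v, hstack v (by simp),
              Relation.ReflTransGen.head ⟨a, hSa, mem_incident.1 ha, rfl⟩ hxw⟩
        · rintro ⟨x, hx, hxw⟩
          exact ⟨x, h1 x hx, hxw⟩
      · rw [pending_scan]
        simp only [pending, List.map_cons, List.sum_cons] at hk ⊢
        omega
      · intro w hw
        rcases h5 w hw with h | h
        · exact h1 w (hstack w (List.mem_cons_of_mem _ h))
        · exact h
      · intro a ha hm hns
        rcases h4 _ hm with h | h
        · by_cases hav : G.near fwd a = v
          · exact h3 a (mem_incident.2 hav) ha
          · refine h1 _ (hclosed a ha h ?_)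
            rw [List.mem_cons]
            rintro (h' | h')
            · exact hav h'
            · exact hns (h2 _ h')
        · exact absurd h.1 hns

/-- Every vertex pays for its own turn; a search costs what its potential loses. -/
theorem time_search (fwd : Bool) (k : ℕ) (mark : Fin n → Bool) (stack : List (Fin n)) :
    (G.search fwd S k mark stack).time
        + pending (fun v => (G.incident fwd v).length + 2) (G.search fwd S k mark stack).val []
      ≤ 1 + pending (fun v => (G.incident fwd v).length + 2) mark stack := by
  induction k generalizing mark stack with
  | zero =>
    change 1 + pending _ mark [] ≤ _
    simp only [pending, List.map_nil, List.sum_nil]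
    omega
  | succ k ih =>
    cases stack with
    | nil => exact le_rfl
    | cons v stack =>
      rw [search_cons]
      have h := ih (G.scan fwd S (G.incident fwd v) mark stack).val.1
        (G.scan fwd S (G.incident fwd v) mark stack).val.2
      rw [pending_scan] at h
      have h2 : pending (fun v => (G.incident fwd v).length + 2) mark (v :: stack)
          = ((G.incident fwd v).length + 2)
            + pending (fun v => (G.incident fwd v).length + 2) mark stack := by
        simp only [pending, List.map_cons, List.sum_cons]
        ring
      simp only [time_scan]
      omega

theorem searchFrom_eq (fwd : Bool) (mark : Fin n → Bool) (v : Fin n) :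
    G.searchFrom fwd S mark v = ⟨(G.search fwd S n (Function.update mark v true) [v]).val,
      1 + (G.search fwd S n (Function.update mark v true) [v]).time⟩ := rfl

theorem searchFrom_spec {fwd : Bool} {mark : Fin n → Bool} {v : Fin n} (hv : mark v = false)
    (hclosed : G.ClosedMarks fwd S mark) (w : Fin n) :
    (G.searchFrom fwd S mark v).val w = true ↔ mark w = true ∨ G.Follow fwd S v w := by
  rw [searchFrom_eq, search_spec]
  · constructor
    · rintro ⟨x, hx, hxw⟩
      by_cases hxv : x = v
      · exact Or.inr (hxv ▸ hxw)
      · rw [Function.update_of_ne hxv] at hx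
        exact Or.inl (hclosed.follow hx hxw)
    · rintro (h | h)
      · refine ⟨w, ?_, Relation.ReflTransGen.refl⟩
        by_cases hwv : w = v
        · simp [hwv]
        · rwa [Function.update_of_ne hwv]
      · exact ⟨v, by simp, h⟩
  · rw [pending_push _ hv]
    simp only [pending, List.map_nil, List.sum_nil, add_zero]
    calc _ ≤ ∑ _w : Fin n, 1 := Finset.sum_le_sum fun w _ => by split_ifs <;> simp
      _ = n := by simp
  · simp
  · intro a ha hm hns
    have hne : G.near fwd a ≠ v := by simpa using hns
    rw [Function.update_of_ne hne] at hm
    by_cases hfv : G.far fwd a = v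
    · simp [hfv]
    · rw [Function.update_of_ne hfv]
      exact hclosed a ha hm

theorem time_searchFrom {fwd : Bool} {mark : Fin n → Bool} {v : Fin n} (hv : mark v = false) :
    (G.searchFrom fwd S mark v).time
        + pending (fun v => (G.incident fwd v).length + 2) (G.searchFrom fwd S mark v).val []
      ≤ 2 + pending (fun v => (G.incident fwd v).length + 2) mark [] := by
  rw [searchFrom_eq]
  have := time_search (G := G) (S := S) fwd n (Function.update mark v true) [v]
  rw [pending_push _ hv] at this
  simp only
  omega

/-! ### Sweeps -/

theorem sweep_cons (fwd : Bool) (S : Fin m → Bool) (v : Fin n) (vs : List (Fin n))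
    (mark : Fin n → Bool) (starts : List (Fin n)) :
    G.sweep fwd S (v :: vs) mark starts =
      if mark v = true then
        ⟨(G.sweep fwd S vs mark starts).val, 1 + (G.sweep fwd S vs mark starts).time⟩
      else
        ⟨(G.sweep fwd S vs (G.searchFrom fwd S mark v).val (v :: starts)).val,
          1 + ((G.searchFrom fwd S mark v).time +
            (G.sweep fwd S vs (G.searchFrom fwd S mark v).val (v :: starts)).time)⟩ := by
  rw [sweep]
  split_ifs <;> rfl

theorem closedMarks_searchFrom {fwd : Bool} {mark : Fin n → Bool} {v : Fin n}
    (hv : mark v = false) (hclosed : G.ClosedMarks fwd S mark) :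
    G.ClosedMarks fwd S (G.searchFrom fwd S mark v).val := by
  intro a ha hm
  rw [searchFrom_spec hv hclosed] at hm ⊢
  rcases hm with h | h
  · exact Or.inl (hclosed a ha h)
  · exact Or.inr (h.tail ⟨a, ha, rfl, rfl⟩)

/-- A sweep adds to the marks everything that can be reached from the vertices of its list. -/
theorem sweep_mark {fwd : Bool} (vs : List (Fin n)) {mark : Fin n → Bool}
    (starts : List (Fin n)) (hclosed : G.ClosedMarks fwd S mark) (w : Fin n) :
    (G.sweep fwd S vs mark starts).val.2 w = true ↔
      mark w = true ∨ ∃ v ∈ vs, G.Follow fwd S v w := by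
  induction vs generalizing mark starts with
  | nil => simp [show (G.sweep fwd S [] mark starts).val.2 = mark from rfl]
  | cons v vs ih =>
    rw [sweep_cons]
    split_ifs with h
    · simp only [ih starts hclosed, List.exists_mem_cons_iff]
      constructor
      · tauto
      · rintro (h' | h' | h')
        · exact Or.inl h'
        · exact Or.inl (hclosed.follow h h')
        · exact Or.inr h'
    · have h : mark v = false := by simpa using h
      simp only [ih _ (closedMarks_searchFrom h hclosed), List.exists_mem_cons_iff,
        searchFrom_spec h hclosed, or_assoc]

/-- A sweep starts a search at `x` if `x` cannot be reached from what comes before it. -/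
theorem mem_sweep {fwd : Bool} (vs : List (Fin n)) {mark : Fin n → Bool}
    (starts : List (Fin n)) (hclosed : G.ClosedMarks fwd S mark) (x : Fin n) :
    x ∈ (G.sweep fwd S vs mark starts).val.1 ↔ x ∈ starts ∨
      ∃ l l', vs = l ++ x :: l' ∧ mark x = false ∧ ∀ v ∈ l, ¬ G.Follow fwd S v x := by
  induction vs generalizing mark starts with
  | nil => simp [show (G.sweep fwd S [] mark starts).val.1 = starts from rfl]
  | cons v vs ih =>
    have hsplit : ∀ mark' : Fin n → Bool, (∃ l l', v :: vs = l ++ x :: l' ∧ mark' x = false ∧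
        ∀ v ∈ l, ¬ G.Follow fwd S v x) ↔ (v = x ∧ mark' x = false) ∨
        (∃ l l', vs = l ++ x :: l' ∧ mark' x = false ∧ ¬ G.Follow fwd S v x ∧
          ∀ v ∈ l, ¬ G.Follow fwd S v x) := by
      intro mark'
      constructor
      · rintro ⟨l, l', h, hm, hl⟩
        cases l with
        | nil =>
          simp only [List.nil_append, List.cons.injEq] at h
          exact Or.inl ⟨h.1, hm⟩
        | cons y l =>
          simp only [List.cons_append, List.cons.injEq] at h
          obtain ⟨rfl, h⟩ := h
          exact Or.inr ⟨l, l', h, hm, hl v (by simp), fun z hz => hl z (by simp [hz])⟩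
      · rintro (⟨rfl, hm⟩ | ⟨l, l', rfl, hm, hv, hl⟩)
        · exact ⟨[], vs, rfl, hm, by simp⟩
        · refine ⟨v :: l, l', rfl, hm, ?_⟩
          simpa using ⟨hv, hl⟩
    rw [sweep_cons, hsplit]
    split_ifs with h
    · simp only [ih starts hclosed]
      constructor
      · rintro (h' | ⟨l, l', rfl, hm, hl⟩)
        · exact Or.inl h'
        · refine Or.inr (Or.inr ⟨l, l', rfl, hm, fun hf => ?_, hl⟩)
          simp [hclosed.follow h hf] at hm
      · rintro (h' | ⟨rfl, hm⟩ | ⟨l, l', rfl, hm, hv, hl⟩)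
        · exact Or.inl h'
        · simp [h] at hm
        · exact Or.inr ⟨l, l', rfl, hm, hl⟩
    · have h : mark v = false := by simpa using h
      simp only [ih _ (closedMarks_searchFrom h hclosed), List.mem_cons]
      have hx : (G.searchFrom fwd S mark v).val x = false ↔
          mark x = false ∧ ¬ G.Follow fwd S v x := by
        rw [← Bool.not_eq_true, searchFrom_spec h hclosed, not_or, Bool.not_eq_true]
      simp only [hx, or_assoc]
      constructor
      · rintro (rfl | h' | ⟨l, l', rfl, ⟨hm, hv⟩, hl⟩)
        · exact Or.inr (Or.inl ⟨rfl, h⟩)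
        · exact Or.inl h'
        · exact Or.inr (Or.inr ⟨l, l', rfl, hm, hv, hl⟩)
      · rintro (h' | ⟨rfl, hm⟩ | ⟨l, l', rfl, hm, hv, hl⟩)
        · exact Or.inr (Or.inl h')
        · exact Or.inl rfl
        · exact Or.inr (Or.inr ⟨l, l', rfl, ⟨hm, hv⟩, hl⟩)

/-- A later starting point cannot be reached from an earlier one. -/
theorem sweep_pairwise {fwd : Bool} (vs : List (Fin n)) {mark : Fin n → Bool}
    {starts : List (Fin n)} (hclosed : G.ClosedMarks fwd S mark)
    (hmark : ∀ x ∈ starts, mark x = true)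
    (hstarts : starts.Pairwise fun a b => ¬ G.Follow fwd S b a) :
    (G.sweep fwd S vs mark starts).val.1.Pairwise fun a b => ¬ G.Follow fwd S b a := by
  induction vs generalizing mark starts with
  | nil => exact hstarts
  | cons v vs ih =>
    rw [sweep_cons]
    split_ifs with h
    · exact ih hclosed hmark hstarts
    · have h : mark v = false := by simpa using h
      refine ih (closedMarks_searchFrom h hclosed) ?_ ?_
      · intro x hx
        rw [searchFrom_spec h hclosed]
        rcases List.mem_cons.1 hx with rfl | hx
        · exact Or.inr Relation.ReflTransGen.refl
        · exact Or.inl (hmark x hx)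
      · refine List.pairwise_cons.2 ⟨fun b hb hf => ?_, hstarts⟩
        simp [hclosed.follow (hmark b hb) hf] at h

theorem time_sweep (fwd : Bool) (vs : List (Fin n)) (mark : Fin n → Bool)
    (starts : List (Fin n)) :
    (G.sweep fwd S vs mark starts).time
        + pending (fun v => (G.incident fwd v).length + 2) (G.sweep fwd S vs mark starts).val.2 []
      ≤ 1 + 3 * vs.length + pending (fun v => (G.incident fwd v).length + 2) mark [] := by
  induction vs generalizing mark starts with
  | nil => exact le_rfl
  | cons v vs ih =>
    rw [sweep_cons]
    split_ifs with h
    · have := ih mark starts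
      simp only [List.length_cons]
      omega
    · have h : mark v = false := by simpa using h
      have h1 := ih (G.searchFrom fwd S mark v).val (v :: starts)
      have h2 := time_searchFrom (G := G) (S := S) (fwd := fwd) h
      simp only [List.length_cons]
      omega

theorem length_sweep (fwd : Bool) (vs : List (Fin n)) (mark : Fin n → Bool)
    (starts : List (Fin n)) :
    (G.sweep fwd S vs mark starts).val.1.length ≤ vs.length + starts.length := by
  induction vs generalizing mark starts with
  | nil => exact (Nat.zero_add _).ge
  | cons v vs ih =>
    rw [sweep_cons]
    split_ifs with h
    · have := ih mark starts
      simp only [List.length_cons]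
      omega
    · have := ih (G.searchFrom fwd S mark v).val (v :: starts)
      simp only [List.length_cons] at this ⊢
      omega

/-! ### Cluster detection -/

theorem closedMarks_false (fwd : Bool) : G.ClosedMarks fwd S (fun _ => false) :=
  fun _ _ h => by simp at h

theorem detect_eq : G.detect S =
    let mark := G.searchFrom false S (fun _ => false) G.root
    let first := G.sweep false S (List.finRange n) mark.val []
    let second := G.sweep false S first.val.1 (fun _ => false) []
    let third := G.sweep true S second.val.1 (fun _ => false) []
    ⟨(second.val.1, third.val.2),
      n + (mark.time + (first.time + (n + (second.time + (n + (third.time + 0))))))⟩ := rfl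

/-- The returned vertices lie in minimal clusters, and every minimal cluster contains one. -/
theorem detect_reps (S : Fin m → Bool) :
    (∀ x ∈ (G.detect S).val.1, ∃ C, G.IsMinimalCluster S C ∧ x ∈ C) ∧
    (∀ C, G.IsMinimalCluster S C → ∃ x ∈ (G.detect S).val.1, x ∈ C) := by
  classical
  rw [detect_eq]
  set mark := (G.searchFrom false S (fun _ => false) G.root).val with hmark
  have hm : ∀ w, mark w = true ↔ G.Reach S w G.root := fun w => by
    rw [hmark, searchFrom_spec rfl (closedMarks_false _), follow_false]
    simp
  have hmc : G.ClosedMarks false S mark := closedMarks_searchFrom rfl (closedMarks_false _)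
  set L := (G.sweep false S (List.finRange n) mark []).val.1 with hL
  have hpw : L.Pairwise fun a b => ¬ G.Reach S a b := by
    have := sweep_pairwise (List.finRange n) hmc (starts := []) (by simp) List.Pairwise.nil
    simpa only [follow_false] using this
  have hLmem := fun x => mem_sweep (List.finRange n) [] hmc x
  have hLroot : ∀ x ∈ L, ¬ G.Reach S x G.root := by
    intro x hx hr
    rw [hL, hLmem x] at hx
    obtain hx | ⟨-, -, -, h, -⟩ := hx
    · simp at hx
    · simp [(hm x).2 hr] at h
  -- every vertex that does not reach the root reaches a starting point of the first sweep: take the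
  -- first vertex in the order of the sweep that it reaches
  have hLcov : ∀ w, ¬ G.Reach S w G.root → ∃ x ∈ L, G.Reach S w x := by
    intro w hw
    obtain ⟨x, hx⟩ : ∃ x, (List.finRange n).find? (fun x => decide (G.Reach S w x)) = some x := by
      rw [← Option.isSome_iff_exists, List.find?_isSome]
      exact ⟨w, by simp, by simpa using Reach.refl w⟩
    rw [List.find?_eq_some_iff_append] at hx
    obtain ⟨hwx, l, l', hl, hnot⟩ := hx
    simp only [decide_eq_true_eq] at hwx
    refine ⟨x, ?_, hwx⟩
    rw [hL, hLmem x]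
    refine Or.inr ⟨l, l', hl, ?_, ?_⟩
    · rw [← Bool.not_eq_true, hm]
      exact fun h => hw (hwx.trans h)
    · intro v hv hf
      rw [follow_false] at hf
      have := hnot v hv
      simp only [Bool.not_eq_true', decide_eq_false_iff_not] at this
      exact this (hwx.trans hf)
  have hacc := fun x => mem_sweep (S := S) (fwd := false) L [] (closedMarks_false (G := G) _) x
  constructor
  · intro x hx
    obtain hx | ⟨l, l', hl, -, hx⟩ := (hacc x).1 hx
    · simp at hx
    have hxL : x ∈ L := by simp [hl]
    -- later starting points precede `x` in `L` and are excluded by the second sweep; earlier ones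
    -- follow `x` in `L` and are excluded by the first
    have honly : ∀ y ∈ L, G.Reach S x y → y = x := by
      intro y hy hxy
      rw [hl] at hy hpw
      rcases List.mem_append.1 hy with hy | hy
      · exact absurd ((follow_false _ _).2 hxy) (hx y hy)
      · rcases List.mem_cons.1 hy with hy | hy
        · exact hy
        · have := (List.pairwise_append.1 hpw).2.1
          exact absurd hxy ((List.pairwise_cons.1 this).1 y hy)
    have hback : ∀ w, G.Reach S x w → G.Reach S w x := by
      intro w hxw
      obtain ⟨y, hy, hwy⟩ := hLcov w fun h => hLroot x hxL (hxw.trans h)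
      exact honly y hy (hxw.trans hwy) ▸ hwy
    obtain ⟨C, hC, hCx⟩ := exists_minimal_of_not_reach (hLroot x hxL)
    obtain ⟨w, hw⟩ := hC.1.1
    exact ⟨C, hC, hC.1.mem_of_reach hw (hback w (hCx w hw))⟩
  · intro C hC
    obtain ⟨w, hw⟩ := hC.1.1
    obtain ⟨x, hxL, hwx⟩ := hLcov w (hC.1.not_reach_root hw)
    have hxC := hC.1.mem_of_reach hw hwx
    refine ⟨x, (hacc x).2 (Or.inr ?_), hxC⟩
    obtain ⟨l, l', hl⟩ := List.append_of_mem hxL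
    refine ⟨l, l', hl, rfl, fun y hy hf => ?_⟩
    rw [follow_false] at hf
    rw [hl] at hpw
    exact (List.pairwise_append.1 hpw).2.2 y hy x (by simp)
      (hC.reach (hC.1.mem_of_reach hxC hf) hxC)

theorem detect_reps_eq_nil_iff :
    (G.detect S).val.1 = [] ↔ G.minimalClusters S = ∅ := by
  rw [List.eq_nil_iff_forall_not_mem, Finset.eq_empty_iff_forall_notMem]
  constructor
  · intro h C hC
    obtain ⟨x, hx, -⟩ := (detect_reps S).2 C (mem_minimalClusters.1 hC)
    exact h x hx
  · intro h x hx
    obtain ⟨C, hC, -⟩ := (detect_reps S).1 x hx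
    exact h C (mem_minimalClusters.2 hC)

/-- The returned marks are those of the union of all minimal clusters. -/
theorem detect_mark (v : Fin n) :
    (G.detect S).val.2 v = true ↔ v ∈ (G.minimalClusters S).biUnion id := by
  have h : (G.detect S).val.2 v = true ↔ _ :=
    sweep_mark (S := S) (fwd := true) (G.detect S).val.1 [] (closedMarks_false (G := G) _) v
  rw [h]
  simp only [Bool.false_eq_true, false_or, Finset.mem_biUnion, id, mem_minimalClusters,
    follow_true]
  constructor
  · rintro ⟨x, hx, hxv⟩
    obtain ⟨C, hC, hxC⟩ := (detect_reps S).1 x hx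
    exact ⟨C, hC, hC.1.mem_of_reach hxC hxv⟩
  · rintro ⟨C, hC, hv⟩
    obtain ⟨x, hx, hxC⟩ := (detect_reps S).2 C hC
    exact ⟨x, hx, hC.reach hxC hv⟩

theorem sum_length_incident (fwd : Bool) : ∑ v, (G.incident fwd v).length = m := by
  have h : ∀ v, (G.incident fwd v).length = 
      (Finset.univ.filter (fun a => G.near fwd a = v)).card := by
    intro v
    rw [← List.toFinset_card_of_nodup]
    · congr 1
      ext a
      simp [mem_incident]
    · cases fwd <;> exact (List.nodup_finRange m).filter _
  simp only [h]
  rw [← Finset.card_eq_sum_card_fiberwise (fun _ _ => Finset.mem_coe.2 (Finset.mem_univ _))]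
  simp

theorem pending_false (fwd : Bool) :
    pending (fun v => (G.incident fwd v).length + 2) (fun _ => false) [] = m + 2 * n := by
  simp [pending, Finset.sum_add_distrib, sum_length_incident, mul_comm]

theorem time_detect_le : (G.detect S).time ≤ 3 * m + 23 * n := by
  have hn : 0 < n := Fin.pos G.root
  rw [detect_eq]
  simp only
  set mark := G.searchFrom false S (fun _ => false) G.root with hmark
  have h0 := time_searchFrom (G := G) (S := S) (fwd := false) (mark := fun _ => false)
    (v := G.root) rfl
  rw [← hmark] at h0
  have h1 := time_sweep (G := G) (S := S) false (List.finRange n) mark.val []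
  have l1 := length_sweep (G := G) (S := S) false (List.finRange n) mark.val []
  set first := G.sweep false S (List.finRange n) mark.val []
  have h2 := time_sweep (G := G) (S := S) false first.val.1 (fun _ => false) []
  have l2 := length_sweep (G := G) (S := S) false first.val.1 (fun _ => false) []
  set second := G.sweep false S first.val.1 (fun _ => false) []
  have h3 := time_sweep (G := G) (S := S) true second.val.1 (fun _ => false) []
  rw [pending_false] at h0 h2 h3
  simp only [List.length_nil, List.length_finRange] at h1 l1 l2
  omega

/-! ### Redrawing and the loop -/

theorem redraw_cons (fresh : Fin m → Bool) (a : Fin m) (as : List (Fin m)) (S : Fin m → Bool) :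
    redraw fresh (a :: as) S = ⟨(redraw fresh as (Function.update S a (fresh a))).val,
      1 + (redraw fresh as (Function.update S a (fresh a))).time⟩ := rfl

theorem redraw_val (fresh : Fin m → Bool) (as : List (Fin m)) (S : Fin m → Bool) (b : Fin m) :
    (redraw fresh as S).val b = if b ∈ as then fresh b else S b := by
  induction as generalizing S with
  | nil => rfl
  | cons a as ih =>
    rw [redraw_cons]
    simp only [ih, List.mem_cons]
    by_cases hb : b ∈ as
    · simp [hb]
    · by_cases hba : b = a
      · subst hba
        simp [hb]
      · simp [hb, hba]

theorem time_redraw (fresh : Fin m → Bool) (as : List (Fin m)) (S : Fin m → Bool) :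
    (redraw fresh as S).time = as.length + 1 := by
  induction as generalizing S with
  | nil => rfl
  | cons a as ih =>
    rw [redraw_cons]
    simp only [ih, List.length_cons]
    ring

theorem redrawMarked_cons (fresh : Fin m → Bool) (mark : Fin n → Bool) (v : Fin n)
    (vs : List (Fin n)) (S : Fin m → Bool) :
    G.redrawMarked fresh mark (v :: vs) S =
      if mark v = true then
        ⟨(G.redrawMarked fresh mark vs (redraw fresh (G.outArcs v) S).val).val,
          1 + ((redraw fresh (G.outArcs v) S).time +
            (G.redrawMarked fresh mark vs (redraw fresh (G.outArcs v) S).val).time)⟩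
      else ⟨(G.redrawMarked fresh mark vs S).val, 1 + (G.redrawMarked fresh mark vs S).time⟩ := by
  rw [redrawMarked]
  split_ifs <;> rfl

theorem redrawMarked_val (fresh : Fin m → Bool) (mark : Fin n → Bool) (vs : List (Fin n))
    (S : Fin m → Bool) (b : Fin m) :
    (G.redrawMarked fresh mark vs S).val b =
      if mark (G.src b) = true ∧ G.src b ∈ vs then fresh b else S b := by
  induction vs generalizing S with
  | nil => simp [show (G.redrawMarked fresh mark [] S).val = S from rfl]
  | cons v vs ih =>
    rw [redrawMarked_cons]
    split_ifs with h <;> grind [redraw_val, outArcs]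

theorem time_redrawMarked_le (fresh : Fin m → Bool) (mark : Fin n → Bool) (vs : List (Fin n))
    (S : Fin m → Bool) :
    (G.redrawMarked fresh mark vs S).time ≤
      1 + (vs.map fun v => (G.outArcs v).length + 2).sum := by
  induction vs generalizing S with
  | nil => exact le_rfl
  | cons v vs ih =>
    rw [redrawMarked_cons]
    simp only [List.map_cons, List.sum_cons]
    split_ifs with h
    · have := ih (redraw fresh (G.outArcs v) S).val
      simp only [time_redraw]
      omega
    · have := ih S
      simp only
      omega

theorem time_redrawMarked_finRange_le (fresh : Fin m → Bool) (mark : Fin n → Bool)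
    (S : Fin m → Bool) :
    (G.redrawMarked fresh mark (List.finRange n) S).time ≤ 1 + m + 2 * n := by
  refine (time_redrawMarked_le _ _ _ _).trans ?_
  have h := sum_length_incident (G := G) true
  rw [← List.ofFn_eq_map, List.sum_ofFn]
  simp only [incident, if_true] at h
  simp only [Finset.sum_add_distrib, h]
  simp
  omega

theorem run_zero (ω : ℕ × Fin m → Bool) : G.run ω 0 =
    let S := redraw (fun a => ω (0, a)) (List.finRange m) (fun _ => false)
    ⟨⟨S.val, (G.detect S.val).val.1, (G.detect S.val).val.2⟩,
      S.time + ((G.detect S.val).time + 0)⟩ := rfl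

theorem run_succ (ω : ℕ × Fin m → Bool) (k : ℕ) : G.run ω (k + 1) =
    let c := G.run ω k
    let S := G.redrawMarked (fun a => ω (k + 1, a)) c.val.inCluster (List.finRange n) c.val.graph
    if c.val.reps = [] then ⟨c.val, c.time + 0⟩
    else ⟨⟨S.val, (G.detect S.val).val.1, (G.detect S.val).val.2⟩,
      c.time + (1 + (S.time + ((G.detect S.val).time + 0)))⟩ := by
  rw [run]
  simp only
  split_ifs with h
  · change Timed.mk _ _ = _
    simp only [bind, pure, h, if_true]
  · change Timed.mk _ _ = _
    simp only [bind, pure, h, if_false]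
    rfl

/-- At the head of its loop the implementation holds the subgraph of cluster popping and the result
of cluster detection for it. -/
theorem run_val (ω : ℕ × Fin m → Bool) (k : ℕ) :
    (G.run ω k).val = ⟨G.state ω k, (G.detect (G.state ω k)).val.1,
      (G.detect (G.state ω k)).val.2⟩ := by
  induction k with
  | zero =>
    have : (redraw (fun a => ω (0, a)) (List.finRange m) (fun _ => false)).val = G.state ω 0 := by
      funext b
      simp [redraw_val, state]
    rw [run_zero]
    simp only [this]
  | succ k ih =>
    rw [run_succ]
    simp only [ih]
    split_ifs with h
    · have : G.state ω (k + 1) = G.state ω k := by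
        rw [detect_reps_eq_nil_iff] at h
        funext a
        simp [state, pop, h]
      rw [this]
    · have : (G.redrawMarked (fun a => ω (k + 1, a)) (G.detect (G.state ω k)).val.2
          (List.finRange n) (G.state ω k)).val = G.state ω (k + 1) := by
        funext b
        rw [redrawMarked_val, state, pop]
        simp only [detect_mark, List.mem_finRange, and_true]
      simp only [this]

theorem initialTime_le (ω : ℕ × Fin m → Bool) : G.initialTime ω ≤ 24 * (m + n) := by
  have hn : 0 < n := Fin.pos G.root
  rw [initialTime, run_zero]
  have := time_detect_le (G := G)
    (S := (redraw (fun a => ω (0, a)) (List.finRange m) (fun _ => false)).val)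
  simp only [time_redraw, List.length_finRange]
  omega

/-- The loop goes on only while there is a minimal cluster, so each iteration can be charged to a
popped cluster. -/
theorem time_run_le (ω : ℕ × Fin m → Bool) (k : ℕ) :
    (G.run ω k).time ≤ G.initialTime ω
      + 27 * (m + n) * ∑ t ∈ Finset.range k, (G.minimalClusters (G.state ω t)).card := by
  have hn : 0 < n := Fin.pos G.root
  induction k with
  | zero => simp [initialTime]
  | succ k ih =>
    rw [run_succ, Finset.sum_range_succ, mul_add]
    simp only
    split_ifs with h
    · simp only
      omega
    · rw [run_val, detect_reps_eq_nil_iff, ← ne_eq, ← Finset.nonempty_iff_ne_empty,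
        ← Finset.card_pos] at h
      have h1 := Nat.le_mul_of_pos_right (27 * (m + n)) h
      have h2 := time_redrawMarked_finRange_le (G := G) (fun a => ω (k + 1, a))
        (G.run ω k).val.inCluster (G.run ω k).val.graph
      have h3 := time_detect_le (G := G) (S := (G.redrawMarked (fun a => ω (k + 1, a))
        (G.run ω k).val.inCluster (List.finRange n) (G.run ω k).val.graph).val)
      simp only
      omega

theorem poppingTime_le (ω : ℕ × Fin m → Bool) :
    G.poppingTime ω ≤ ((27 * (m + n) : ℕ) : ℝ≥0∞) * G.poppedClusters ω := by
  rw [poppingTime, tsub_le_iff_left, runningTime]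
  refine iSup_le fun k => ?_
  calc ((G.run ω k).time : ℝ≥0∞)
      ≤ ((G.initialTime ω + 27 * (m + n) *
          ∑ t ∈ Finset.range k, (G.minimalClusters (G.state ω t)).card : ℕ) : ℝ≥0∞) :=
        Nat.cast_le.2 (time_run_le ω k)
    _ = G.initialTime ω + ((27 * (m + n) : ℕ) : ℝ≥0∞) *
          ∑ t ∈ Finset.range k, ((G.minimalClusters (G.state ω t)).card : ℝ≥0∞) := by
        push_cast
        rfl
    _ ≤ _ := by
        gcongr
        exact ENNReal.sum_le_tsum _

theorem runningTime_le (ω : ℕ × Fin m → Bool) :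
    G.runningTime ω ≤ G.initialTime ω + G.poppingTime ω := by
  rw [poppingTime]
  exact le_add_tsub

end RootedDigraph

/-! ### Resampling the arcs that leave a set of vertices -/

namespace RootedDigraph

variable {n m : ℕ} {G : RootedDigraph n m}

/-- The subgraph that takes the arcs leaving `U` from `R` and all other arcs from `S`. -/
def mix (G : RootedDigraph n m) (U : Finset (Fin n)) (R S : Fin m → Bool) : Fin m → Bool :=
  fun a => if G.src a ∈ U then R a else S a

theorem pop_eq_mix (R S : Fin m → Bool) :
    G.pop R S = G.mix ((G.minimalClusters S).biUnion id) R S := rfl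

theorem mix_mix (U : Finset (Fin n)) (R S : Fin m → Bool) :
    G.mix U (G.mix U R S) (G.mix U S R) = R := by
  funext a
  simp only [mix]
  split_ifs <;> rfl

/-- The minimal clusters that are disjoint from `U`. -/
def clustersOff (U : Finset (Fin n)) (J : Finset (Finset (Fin n))) :
    Finset (Finset (Fin n)) :=
  J.filter fun C => Disjoint C U

theorem subset_minimalClusters_mix (I : Finset (Finset (Fin n))) (R S : Fin m → Bool) :
    I ⊆ G.minimalClusters (G.mix (I.biUnion id) R S) ↔ I ⊆ G.minimalClusters R := by
  refine forall₂_congr fun C hC => ?_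
  rw [mem_minimalClusters, mem_minimalClusters]
  refine isMinimalCluster_congr fun a ha => if_pos ?_
  exact Finset.mem_biUnion.2 ⟨C, hC, ha⟩

theorem clustersOff_mix (U : Finset (Fin n)) (R S : Fin m → Bool) :
    clustersOff U (G.minimalClusters (G.mix U R S)) = clustersOff U (G.minimalClusters S) := by
  ext C
  simp only [clustersOff, Finset.mem_filter, mem_minimalClusters]
  refine and_congr_left fun hC => isMinimalCluster_congr fun a ha => if_neg ?_
  exact Finset.disjoint_left.1 hC ha

theorem clustersOff_of_subset {I : Finset (Finset (Fin n))} {S : Fin m → Bool}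
    (hI : I ⊆ G.minimalClusters S) :
    clustersOff (I.biUnion id) (G.minimalClusters S) = G.minimalClusters S \ I := by
  ext C
  simp only [clustersOff, Finset.mem_filter, Finset.mem_sdiff, Finset.disjoint_biUnion_right, id]
  refine and_congr_right fun hC => ?_
  constructor
  · intro h hCI
    have := h C hCI
    rw [disjoint_self, Finset.bot_eq_empty] at this
    exact (mem_minimalClusters.1 hC).1.1.ne_empty this
  · intro hCI D hD
    exact (mem_minimalClusters.1 hC).disjoint (mem_minimalClusters.1 (hI hD))
      fun h => hCI (h ▸ hD)

/-- That `I` is the set of all minimal clusters splits into an event about the arcs that leave `⋃ I`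
and an event about the other arcs. -/
theorem minimalClusters_eq_iff {I : Finset (Finset (Fin n))} {S : Fin m → Bool} :
    G.minimalClusters S = I ↔
      I ⊆ G.minimalClusters S ∧ clustersOff (I.biUnion id) (G.minimalClusters S) = ∅ := by
  constructor
  · rintro rfl
    exact ⟨subset_rfl, by rw [clustersOff_of_subset subset_rfl, Finset.sdiff_self]⟩
  · rintro ⟨h1, h2⟩
    rw [clustersOff_of_subset h1, Finset.sdiff_eq_empty_iff_subset] at h2
    exact h2.antisymm h1

theorem clustersOff_erase (U : Finset (Fin n)) (J : Finset (Finset (Fin n)))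
    (C : Finset (Fin n)) : clustersOff U (J.erase C) = (clustersOff U J).erase C := by
  simp only [clustersOff, Finset.filter_erase]

end RootedDigraph

/-- Among the ways to erase an element of `J ⊇ X`, exactly one empties `X` if `X` has one element,
and none does if `X` has more. -/
theorem Finset.sum_ite_eq_empty_sub_ite_erase {α : Type*} [DecidableEq α] {X J : Finset α}
    (h : X ⊆ J) :
    ∑ C ∈ J, ((if X = ∅ then (1 : ℝ) else 0) - if X.erase C = ∅ then 1 else 0)
      = -if X.card = 1 then 1 else 0 := by
  by_cases hX : X = ∅
  · subst hX
    simp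
  by_cases hc : X.card = 1
  · obtain ⟨D, rfl⟩ := Finset.card_eq_one.1 hc
    rw [Finset.sum_eq_single D]
    · simp
    · intro C _ hCD
      rw [Finset.erase_eq_of_notMem (by simpa using hCD)]
      simp
    · intro hD
      exact absurd (h (by simp)) hD
  · rw [if_neg hc, neg_zero]
    refine Finset.sum_eq_zero fun C _ => ?_
    rw [if_neg hX, if_neg, sub_zero]
    intro he
    have hs := Finset.erase_eq_empty_iff X C |>.1 he
    rcases hs with hs | hs
    · exact hX hs
    · exact hc (by simp [hs])

theorem Finset.sum_ite_card_sdiff_eq_one {α : Type*} [DecidableEq α] [Fintype α] (J : Finset α)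
    (f : Finset α → ℝ) :
    ∑ I, (if I ⊆ J ∧ (J \ I).card = 1 then f I else 0) = ∑ C ∈ J, f (J.erase C) := by
  rw [← Finset.sum_filter, ← Finset.sum_image (g := fun C => J.erase C) (f := f)]
  · refine Finset.sum_congr ?_ fun _ _ => rfl
    ext I
    simp only [Finset.mem_filter, Finset.mem_univ, true_and, Finset.mem_image]
    constructor
    · rintro ⟨hI, hc⟩
      obtain ⟨C, hC⟩ := Finset.card_eq_one.1 hc
      refine ⟨C, (Finset.mem_sdiff.1 (hC.symm ▸ Finset.mem_singleton_self C)).1, ?_⟩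
      rw [Finset.erase_eq, ← hC, Finset.sdiff_sdiff_eq_self hI]
    · rintro ⟨C, hC, rfl⟩
      refine ⟨Finset.erase_subset _ _, ?_⟩
      rw [Finset.erase_eq, Finset.sdiff_sdiff_eq_self (by simpa using hC)]
      simp
  · exact Finset.erase_injOn J

namespace Network

open RootedDigraph (clustersOff)

variable {n m : ℕ} (N : Network n m)

/-- The probability of a subgraph under independent draws of all arcs. -/
noncomputable def weight (S : Fin m → Bool) : ℝ := ∏ a, if S a = true then 1 - N.p a else N.p a

theorem weight_pos (S : Fin m → Bool) : 0 < N.weight S := by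
  refine Finset.prod_pos fun a _ => ?_
  split_ifs
  · exact sub_pos.2 (N.p_lt_one a)
  · exact N.p_pos a

theorem sum_weight : ∑ S, N.weight S = 1 := by
  simp only [weight]
  rw [← Fintype.prod_sum (fun (a : Fin m) (b : Bool) => if b = true then 1 - N.p a else N.p a)]
  simp

theorem weight_mix (U : Finset (Fin n)) (R S : Fin m → Bool) :
    N.weight (N.mix U R S) * N.weight (N.mix U S R) = N.weight S * N.weight R := by
  simp only [weight, ← Finset.prod_mul_distrib]
  refine Finset.prod_congr rfl fun a _ => ?_
  simp only [RootedDigraph.mix]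
  by_cases h : N.src a ∈ U
  · simp only [h, if_true]
    ring
  · simp only [h, if_false]

/-- The joint law of two independent subgraphs does not change if they exchange the arcs that leave
`U`. -/
theorem sum_sum_mix (U : Finset (Fin n)) (g : (Fin m → Bool) → (Fin m → Bool) → ℝ) :
    ∑ S, ∑ R, N.weight S * N.weight R * g (N.mix U R S) (N.mix U S R)
      = ∑ S, ∑ R, N.weight S * N.weight R * g S R := by
  rw [← Fintype.sum_prod_type', ← Fintype.sum_prod_type']
  let σ : (Fin m → Bool) × (Fin m → Bool) → (Fin m → Bool) × (Fin m → Bool) :=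
    fun x => (N.mix U x.2 x.1, N.mix U x.1 x.2)
  have hσ : Function.Involutive σ := fun x => by
    simp only [σ, RootedDigraph.mix_mix, Prod.mk.eta]
  refine Fintype.sum_equiv hσ.toPerm _ _ fun x => ?_
  change _ = N.weight (N.mix U x.2 x.1) * N.weight (N.mix U x.1 x.2) * _
  rw [weight_mix]
  rfl

/-- If `F` depends only on the arcs that leave `U`, and `H` only on the other arcs, then redrawing
the arcs that leave `U` makes `F` independent of the result. -/
theorem sum_sum_resample {U : Finset (Fin n)} {F H : (Fin m → Bool) → ℝ}
    (hF : ∀ R S, F (N.mix U R S) = F R) (hH : ∀ R S, H (N.mix U R S) = H S)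
    (f : (Fin m → Bool) → ℝ) :
    ∑ S, ∑ R, N.weight S * N.weight R * (F S * H S * f (N.mix U R S))
      = (∑ S, N.weight S * F S) * ∑ S, N.weight S * (H S * f S) := by
  have h := N.sum_sum_mix U fun S R => F R * H S * f S
  simp only [hF, hH] at h
  rw [h, mul_comm, Finset.sum_mul_sum]
  refine Finset.sum_congr rfl fun S _ => Finset.sum_congr rfl fun R _ => ?_
  ring

theorem sum_weight_mul_mul {U : Finset (Fin n)} {F H : (Fin m → Bool) → ℝ}
    (hF : ∀ R S, F (N.mix U R S) = F R) (hH : ∀ R S, H (N.mix U R S) = H S) :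
    ∑ S, N.weight S * (F S * H S) = (∑ S, N.weight S * F S) * ∑ S, N.weight S * H S := by
  have h := N.sum_sum_resample hF hH fun _ => 1
  simp only [mul_one] at h
  rw [← h]
  refine Finset.sum_congr rfl fun S _ => ?_
  simp only [mul_assoc, ← Finset.mul_sum, ← Finset.sum_mul, N.sum_weight, one_mul]

/-! ### The law of the subgraph after `t` iterations -/

/-- The probability that all members of `I` are minimal clusters. -/
noncomputable def containProb (I : Finset (Finset (Fin n))) : ℝ :=
  ∑ S, N.weight S * if I ⊆ N.minimalClusters S then 1 else 0

/-- The density of the law of the subgraph after `t` iterations with respect to the initial law. It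
depends on the set `J` of minimal clusters only: after the clusters in `I` have been popped, the
subgraph has the initial law restricted to the event that every minimal cluster meets `⋃ I`. -/
noncomputable def density : ℕ → Finset (Finset (Fin n)) → ℝ
  | 0, _ => 1
  | t + 1, J => ∑ I, density t I * (N.containProb I *
      if clustersOff (I.biUnion id) J = ∅ then 1 else 0)

theorem containProb_nonneg (I : Finset (Finset (Fin n))) : 0 ≤ N.containProb I :=
  Finset.sum_nonneg fun S _ => mul_nonneg (N.weight_pos S).le (by split_ifs <;> simp)

theorem density_nonneg (t : ℕ) (J : Finset (Finset (Fin n))) : 0 ≤ N.density t J := by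
  induction t generalizing J with
  | zero => exact zero_le_one
  | succ t ih =>
    exact Finset.sum_nonneg fun I _ => mul_nonneg (ih I)
      (mul_nonneg (N.containProb_nonneg I) (by split_ifs <;> simp))

/-- One iteration turns the density at time `t` into the density at time `t + 1`. -/
theorem sum_density_pop (t : ℕ) (f : (Fin m → Bool) → ℝ) :
    ∑ S, ∑ R, N.weight S * N.weight R * (N.density t (N.minimalClusters S) * f (N.pop R S))
      = ∑ S, N.weight S * (N.density (t + 1) (N.minimalClusters S) * f S) := by
  have h1 : ∀ S R, N.density t (N.minimalClusters S) * f (N.pop R S) =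
      ∑ I, N.density t I * ((if I ⊆ N.minimalClusters S then 1 else 0) *
        (if clustersOff (I.biUnion id) (N.minimalClusters S) = ∅ then 1 else 0) *
        f (N.mix (I.biUnion id) R S)) := by
    intro S R
    rw [Finset.sum_eq_single (N.minimalClusters S), RootedDigraph.pop_eq_mix,
      if_pos subset_rfl, if_pos (RootedDigraph.minimalClusters_eq_iff.1 rfl).2, one_mul, one_mul]
    · intro I _ hI
      have h := fun h => hI (RootedDigraph.minimalClusters_eq_iff.2 h).symm
      split_ifs with h1 h2
      · exact (h ⟨h1, h2⟩).elim
      all_goals simp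
    · simp
  have h2 : ∀ I : Finset (Finset (Fin n)), ∑ S, ∑ R, N.weight S * N.weight R *
      ((if I ⊆ N.minimalClusters S then (1 : ℝ) else 0) *
        (if clustersOff (I.biUnion id) (N.minimalClusters S) = ∅ then 1 else 0) *
        f (N.mix (I.biUnion id) R S)) = N.containProb I * ∑ S, N.weight S *
        ((if clustersOff (I.biUnion id) (N.minimalClusters S) = ∅ then 1 else 0) * f S) := by
    intro I
    refine N.sum_sum_resample (F := fun S => if I ⊆ N.minimalClusters S then (1 : ℝ) else 0)
      (H := fun S => if clustersOff (I.biUnion id) (N.minimalClusters S) = ∅ then 1 else 0)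
      ?_ ?_ f
    · exact fun R S => by simp only [RootedDigraph.subset_minimalClusters_mix]
    · exact fun R S => by simp only [RootedDigraph.clustersOff_mix]
  calc _ = ∑ I, N.density t I * ∑ S, ∑ R, N.weight S * N.weight R *
      ((if I ⊆ N.minimalClusters S then (1 : ℝ) else 0) *
        (if clustersOff (I.biUnion id) (N.minimalClusters S) = ∅ then 1 else 0) *
        f (N.mix (I.biUnion id) R S)) := by
        simp only [h1, Finset.mul_sum]
        refine Eq.trans (Finset.sum_congr rfl fun S _ => ?_) Finset.sum_comm
        rw [Finset.sum_comm]
        refine Finset.sum_congr rfl fun I _ => Finset.sum_congr rfl fun R _ => ?_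
        ring
    _ = _ := by
        simp only [h2, density, Finset.mul_sum, Finset.sum_mul]
        rw [Finset.sum_comm]
        refine Finset.sum_congr rfl fun S _ => Finset.sum_congr rfl fun I _ => ?_
        ring

theorem sum_density (t : ℕ) :
    ∑ S, N.weight S * N.density t (N.minimalClusters S) = 1 := by
  induction t with
  | zero => simpa [density] using N.sum_weight
  | succ t ih =>
    have h := N.sum_density_pop t fun _ => 1
    simp only [mul_one] at h
    rw [← h, ← ih]
    refine Finset.sum_congr rfl fun S _ => ?_
    rw [← Finset.sum_mul, ← Finset.mul_sum, N.sum_weight, mul_one]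

/-! ### The expected number of popped clusters -/

/-- The expected number of clusters popped in the iteration that starts at time `t`. -/
noncomputable def expPopped (t : ℕ) : ℝ :=
  ∑ S, N.weight S * (N.density t (N.minimalClusters S) * (N.minimalClusters S).card)

/-- The sum over a subgraph and one of its minimal clusters of the density without this cluster. -/
noncomputable def erasedDensity (t : ℕ) : ℝ :=
  ∑ S, N.weight S * ∑ C ∈ N.minimalClusters S, N.density t ((N.minimalClusters S).erase C)

theorem expPopped_nonneg (t : ℕ) : 0 ≤ N.expPopped t :=
  Finset.sum_nonneg fun S _ => mul_nonneg (N.weight_pos S).le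
    (mul_nonneg (N.density_nonneg _ _) (Nat.cast_nonneg _))

theorem erasedDensity_zero : N.erasedDensity 0 = N.expPopped 0 := by
  simp [erasedDensity, expPopped, density]

/-- For a fixed popped family `I`, the difference of the two sums at time `t + 1` counts the
subgraphs with exactly one minimal cluster off `⋃ I`. This event concerns the arcs that do not leave
`⋃ I`, so together with the factor `containProb I` it is the event that the minimal clusters are
those in `I` and one more. -/
theorem erasedDensity_succ (t : ℕ) :
    N.erasedDensity (t + 1) = N.erasedDensity t + N.expPopped (t + 1) := by
  have h1 : N.expPopped (t + 1) - N.erasedDensity (t + 1) =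
      -∑ I, N.density t I * (N.containProb I * ∑ S, N.weight S *
        if (clustersOff (I.biUnion id) (N.minimalClusters S)).card = 1 then 1 else 0) := by
    have h : ∀ S, N.density (t + 1) (N.minimalClusters S) * (N.minimalClusters S).card
        - ∑ C ∈ N.minimalClusters S, N.density (t + 1) ((N.minimalClusters S).erase C)
        = ∑ I, N.density t I * (N.containProb I *
          -if (clustersOff (I.biUnion id) (N.minimalClusters S)).card = 1 then 1 else 0) := by
      intro S
      have h' := fun I : Finset (Finset (Fin n)) => Finset.sum_ite_eq_empty_sub_ite_erase
        (X := clustersOff (I.biUnion id) (N.minimalClusters S)) (J := N.minimalClusters S)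
        (Finset.filter_subset _ _)
      rw [mul_comm, ← nsmul_eq_mul, ← Finset.sum_const, ← Finset.sum_sub_distrib]
      simp only [density, ← Finset.sum_sub_distrib, ← mul_sub, RootedDigraph.clustersOff_erase]
      rw [Finset.sum_comm]
      simp only [← Finset.mul_sum, h']
    rw [expPopped, erasedDensity, ← Finset.sum_sub_distrib]
    simp only [← mul_sub, h]
    simp only [Finset.mul_sum, mul_neg, Finset.sum_neg_distrib]
    rw [Finset.sum_comm]
    congr 1
    refine Finset.sum_congr rfl fun I _ => Finset.sum_congr rfl fun S _ => ?_
    ring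
  have h2 : N.erasedDensity t =
      ∑ I, N.density t I * (N.containProb I * ∑ S, N.weight S *
        if (clustersOff (I.biUnion id) (N.minimalClusters S)).card = 1 then 1 else 0) := by
    have h : ∀ I : Finset (Finset (Fin n)), N.containProb I * ∑ S, N.weight S *
        (if (clustersOff (I.biUnion id) (N.minimalClusters S)).card = 1 then (1 : ℝ) else 0)
        = ∑ S, N.weight S *
          if I ⊆ N.minimalClusters S ∧ (N.minimalClusters S \ I).card = 1 then 1 else 0 := by
      intro I
      rw [containProb, ← N.sum_weight_mul_mul (U := I.biUnion id)
        (F := fun S => if I ⊆ N.minimalClusters S then 1 else 0)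
        (H := fun S => if (clustersOff (I.biUnion id) (N.minimalClusters S)).card = 1
          then 1 else 0)]
      · refine Finset.sum_congr rfl fun S _ => ?_
        by_cases hI : I ⊆ N.minimalClusters S
        · rw [RootedDigraph.clustersOff_of_subset hI]
          simp [hI]
        · simp [hI]
      · exact fun R S => by simp only [RootedDigraph.subset_minimalClusters_mix]
      · exact fun R S => by simp only [RootedDigraph.clustersOff_mix]
    simp only [h, erasedDensity, ← Finset.sum_ite_card_sdiff_eq_one, Finset.mul_sum]
    rw [Finset.sum_comm]
    refine Finset.sum_congr rfl fun I _ => Finset.sum_congr rfl fun S _ => ?_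
    split_ifs <;> ring
  linarith

theorem sum_expPopped (t : ℕ) :
    ∑ s ∈ Finset.range (t + 1), N.expPopped s = N.erasedDensity t := by
  induction t with
  | zero => simp [erasedDensity_zero]
  | succ t ih => rw [Finset.sum_range_succ, ih, erasedDensity_succ]

/-- The probability that `J` is the set of all minimal clusters. -/
noncomputable def exactProb (J : Finset (Finset (Fin n))) : ℝ :=
  ∑ S, if N.minimalClusters S = J then N.weight S else 0

/-- The probability that there is exactly one minimal cluster. -/
noncomputable def oneClusterProb : ℝ :=
  ∑ S, if (N.minimalClusters S).card = 1 then N.weight S else 0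

/-- With all other arcs present, every family of minimal clusters of some subgraph is the set of all
minimal clusters. -/
theorem exactProb_pos (hconn : N.IsRootConnected) {S : Fin m → Bool}
    {J : Finset (Finset (Fin n))} (hJ : J ⊆ N.minimalClusters S) : 0 < N.exactProb J := by
  refine Finset.sum_pos' (fun S _ => ?_) ⟨N.mix (J.biUnion id) S fun _ => true,
    Finset.mem_univ _, ?_⟩
  · split_ifs
    · exact (N.weight_pos S).le
    · exact le_rfl
  · rw [if_pos]
    · exact N.weight_pos _
    rw [RootedDigraph.minimalClusters_eq_iff, RootedDigraph.subset_minimalClusters_mix,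
      RootedDigraph.clustersOff_mix]
    refine ⟨hJ, ?_⟩
    have : N.minimalClusters (fun _ => true) = ∅ := by
      rw [RootedDigraph.minimalClusters_eq_empty_iff_reach]
      intro v
      exact (hconn v).lift id fun u w ⟨a, h⟩ => ⟨a, rfl, h⟩
    simp [this, clustersOff]

theorem density_mul_exactProb (t : ℕ) (J : Finset (Finset (Fin n))) :
    N.density t J * N.exactProb J = ∑ S, N.weight S *
      if N.minimalClusters S = J then N.density t (N.minimalClusters S) else 0 := by
  rw [exactProb, Finset.mul_sum]
  refine Finset.sum_congr rfl fun S _ => ?_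
  split_ifs with h
  · rw [h, mul_comm]
  · simp

theorem density_mul_exactProb_le_one (t : ℕ) (J : Finset (Finset (Fin n))) :
    N.density t J * N.exactProb J ≤ 1 := by
  rw [density_mul_exactProb, ← N.sum_density t]
  refine Finset.sum_le_sum fun S _ => mul_le_mul_of_nonneg_left ?_ (N.weight_pos S).le
  split_ifs
  · exact le_rfl
  · exact N.density_nonneg _ _

theorem density_mul_exactProb_le (t : ℕ) {J : Finset (Finset (Fin n))} (hJ : J ≠ ∅) :
    N.density t J * N.exactProb J ≤ N.expPopped t := by
  rw [density_mul_exactProb, expPopped]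
  refine Finset.sum_le_sum fun S _ => mul_le_mul_of_nonneg_left ?_ (N.weight_pos S).le
  split_ifs with h
  · refine le_mul_of_one_le_right (N.density_nonneg _ _) ?_
    rw [Nat.one_le_cast, Nat.one_le_iff_ne_zero, Finset.card_ne_zero, h]
    exact Finset.nonempty_iff_ne_empty.2 hJ
  · exact mul_nonneg (N.density_nonneg _ _) (Nat.cast_nonneg _)

/-- In the sum that defines `erasedDensity t`, the subgraphs with one minimal cluster contribute at
most the ratio on the right. All other terms are bounded by a constant times `expPopped t`, which
tends to zero since the partial sums are bounded. -/
theorem sum_expPopped_le (hconn : N.IsRootConnected) (k : ℕ) :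
    ∑ t ∈ Finset.range k, N.expPopped t ≤ N.oneClusterProb / N.exactProb ∅ := by
  -- the probabilities in the denominators are positive by `exactProb_pos`
  set K : ℝ := ∑ S, N.weight S * ∑ C ∈ N.minimalClusters S,
    (N.exactProb ((N.minimalClusters S).erase C))⁻¹ with hK
  have hpos : ∀ S, ∀ C, 0 < N.exactProb ((N.minimalClusters S).erase C) := fun S C =>
    N.exactProb_pos hconn (Finset.erase_subset _ _)
  have hbound : ∀ t, N.erasedDensity t ≤ K := fun t => by
    refine Finset.sum_le_sum fun S _ => mul_le_mul_of_nonneg_left ?_ (N.weight_pos S).le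
    refine Finset.sum_le_sum fun C _ => ?_
    rw [← one_div, le_div_iff₀ (hpos S C)]
    exact N.density_mul_exactProb_le_one _ _
  have hle : ∀ t, N.erasedDensity t ≤
      N.oneClusterProb / N.exactProb ∅ + N.expPopped t * K := fun t => by
    have : N.oneClusterProb / N.exactProb ∅ + N.expPopped t * K = ∑ S, N.weight S *
        ∑ C ∈ N.minimalClusters S, ((if (N.minimalClusters S).erase C = ∅ then 1 else 0)
          * (N.exactProb ∅)⁻¹ +
          N.expPopped t * (N.exactProb ((N.minimalClusters S).erase C))⁻¹) := by
      simp only [Finset.sum_add_distrib, mul_add]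
      congr 1
      · rw [oneClusterProb, div_eq_mul_inv, Finset.sum_mul]
        refine Finset.sum_congr rfl fun S _ => ?_
        rw [← Finset.sum_mul, ← mul_assoc]
        congr 1
        by_cases h0 : N.minimalClusters S = ∅
        · simp [h0]
        have h := Finset.sum_ite_eq_empty_sub_ite_erase (subset_refl (N.minimalClusters S))
        simp only [h0, if_false, zero_sub, Finset.sum_neg_distrib, neg_inj] at h
        rw [h]
        simp
      · rw [hK, Finset.mul_sum]
        refine Finset.sum_congr rfl fun S _ => ?_
        rw [← Finset.mul_sum]
        ring
    rw [this]
    refine Finset.sum_le_sum fun S _ => mul_le_mul_of_nonneg_left ?_ (N.weight_pos S).le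
    refine Finset.sum_le_sum fun C _ => ?_
    by_cases h : (N.minimalClusters S).erase C = ∅
    · have h1 := N.density_mul_exactProb_le_one t ((N.minimalClusters S).erase C)
      have h2 := hpos S C
      rw [← le_div_iff₀ h2, one_div] at h1
      rw [if_pos h, one_mul]
      have := mul_nonneg (N.expPopped_nonneg t) (inv_nonneg.2 h2.le)
      rw [h] at *
      linarith
    · have h1 := N.density_mul_exactProb_le t h
      rw [← le_div_iff₀ (hpos S C), div_eq_mul_inv] at h1
      rw [if_neg h, zero_mul, zero_add]
      exact h1
  have hsum : Summable N.expPopped := by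
    refine summable_of_sum_range_le (c := K) N.expPopped_nonneg fun j => ?_
    refine le_trans ?_ (hbound j)
    rw [← sum_expPopped, Finset.sum_range_succ]
    exact le_add_of_nonneg_right (N.expPopped_nonneg j)
  have hlim : Filter.Tendsto (fun t => N.oneClusterProb / N.exactProb ∅ + N.expPopped t * K)
      Filter.atTop (nhds (N.oneClusterProb / N.exactProb ∅)) := by
    simpa using (hsum.tendsto_atTop_zero.mul_const K).const_add (N.oneClusterProb / N.exactProb ∅)
  refine ge_of_tendsto hlim (Filter.eventually_atTop.2 ⟨k, fun t ht => ?_⟩)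
  refine le_trans ?_ (hle t)
  rw [← sum_expPopped]
  exact Finset.sum_le_sum_of_subset_of_nonneg (Finset.range_subset_range.2 (by omega))
    fun s _ _ => N.expPopped_nonneg s

end Network

/-! ### The coins -/

namespace RootedDigraph

variable {n m : ℕ} {G : RootedDigraph n m}

theorem state_congr {ω ω' : ℕ × Fin m → Bool} {t : ℕ} (h : ∀ s ≤ t, ∀ a, ω (s, a) = ω' (s, a)) :
    G.state ω t = G.state ω' t := by
  induction t with
  | zero => exact funext fun a => h 0 le_rfl a
  | succ t ih =>
    rw [state, state, ih fun s hs => h s (hs.trans t.le_succ)]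
    congr 1
    exact funext fun a => h (t + 1) le_rfl a

theorem measurable_state (t : ℕ) : Measurable fun ω => G.state ω t := by
  induction t with
  | zero => exact measurable_pi_lambda _ fun a => measurable_pi_apply _
  | succ t ih =>
    have h : Measurable fun ω : ℕ × Fin m → Bool => fun a => ω (t + 1, a) :=
      measurable_pi_lambda _ fun a => measurable_pi_apply _
    have h' := (measurable_of_countable
      fun x : (Fin m → Bool) × (Fin m → Bool) => G.pop x.1 x.2).comp (h.prodMk ih)
    simp only [state]
    exact h'

end RootedDigraph

namespace Network

variable {n m : ℕ} (N : Network n m)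

theorem weight_nonneg_mul_density (t : ℕ) (S : Fin m → Bool) :
    0 ≤ N.weight S * N.density t (N.minimalClusters S) :=
  mul_nonneg (N.weight_pos S).le (N.density_nonneg _ _)

theorem coins_fresh (t : ℕ) (R : Fin m → Bool) :
    N.coins {ω | (fun a => ω (t, a)) = R} = ENNReal.ofReal (N.weight R) := by
  classical
  have hset : {ω : ℕ × Fin m → Bool | (fun a => ω (t, a)) = R}
      = Set.pi ↑(({t} : Finset ℕ) ×ˢ (Finset.univ : Finset (Fin m))) fun x => {R x.2} := by
    ext ω
    simp only [Set.mem_ofPred_eq, funext_iff, Set.mem_pi, Finset.mem_coe, Finset.mem_product,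
      Finset.mem_singleton, Finset.mem_univ, and_true, Prod.forall, Set.mem_singleton_iff]
    exact ⟨fun h s a hs => hs ▸ h a, fun h a => h t a rfl⟩
  rw [hset, coins, Measure.infinitePi_pi _ fun _ _ => measurableSet_singleton _,
    Finset.prod_product, Finset.prod_singleton, weight, ENNReal.ofReal_prod_of_nonneg]
  · refine Finset.prod_congr rfl fun a _ => ?_
    rw [coin]
    cases h : R a
    · rw [bernoulliMeasure_apply_of_mem_of_notMem _ (by simp) (by simp) (by simp)]
      simp [ENNReal.ofReal, Real.toNNReal_of_nonneg (N.p_pos a).le]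
      rfl
    · rw [bernoulliMeasure_apply_of_notMem_of_mem _ (by simp) (by simp) (by simp)]
      simp [ENNReal.ofReal, Real.toNNReal_of_nonneg (sub_nonneg.2 (N.p_lt_one a).le)]
      rfl
  · intro a _
    split_ifs
    · exact sub_nonneg.2 (N.p_lt_one a).le
    · exact (N.p_pos a).le

/-- The coins of time `t + 1` are independent of the subgraph at time `t`. -/
theorem indepFun_state_fresh (t : ℕ) :
    IndepFun (fun ω => N.state ω t) (fun ω a => ω (t + 1, a)) N.coins := by
  classical
  have hind : iIndepFun (fun (x : ℕ × Fin m) (ω : ℕ × Fin m → Bool) => ω x) N.coins :=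
    iIndepFun_infinitePi (P := fun x : ℕ × Fin m => N.coin x.2) (X := fun _ b => b)
      fun _ => measurable_id
  have h := hind.indepFun_finset (Finset.range (t + 1) ×ˢ Finset.univ) ({t + 1} ×ˢ Finset.univ)
    (by
      rw [Finset.disjoint_left]
      rintro ⟨s, a⟩ h1 h2
      simp only [Finset.mem_product, Finset.mem_range, Finset.mem_singleton, Finset.mem_univ,
        and_true] at h1 h2
      omega)
    fun x => measurable_pi_apply x
  have h' := h.comp
    (φ := fun y => N.state (fun x => if hx : x ∈ Finset.range (t + 1) ×ˢ Finset.univ then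
      y ⟨x, hx⟩ else false) t)
    (ψ := fun y a => y ⟨(t + 1, a), by simp⟩) (measurable_of_countable _)
    (measurable_of_countable _)
  refine h'.congr (Filter.Eventually.of_forall fun ω => ?_)
    (Filter.Eventually.of_forall fun ω => rfl)
  refine RootedDigraph.state_congr fun s hs a => ?_
  rw [dif_pos]
  simpa [Nat.lt_succ_iff] using hs

/-- The law of the subgraph after `t` iterations. -/
theorem coins_state (t : ℕ) (S : Fin m → Bool) :
    N.coins {ω | N.state ω t = S}
      = ENNReal.ofReal (N.weight S * N.density t (N.minimalClusters S)) := by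
  classical
  induction t generalizing S with
  | zero =>
    rw [density, mul_one]
    exact N.coins_fresh 0 S
  | succ t ih =>
    have hset : {ω | N.state ω (t + 1) = S} = ⋃ x ∈ (Finset.univ.filter
        fun x : (Fin m → Bool) × (Fin m → Bool) => N.pop x.2 x.1 = S),
        ({ω | N.state ω t = x.1} ∩ {ω | (fun a => ω (t + 1, a)) = x.2}) := by
      ext ω
      simp only [Set.mem_ofPred_eq, Finset.mem_filter, Finset.mem_univ, true_and, Set.mem_iUnion,
        Set.mem_inter_iff, Prod.exists, exists_prop]
      constructor
      · exact fun h => ⟨_, _, h, rfl, rfl⟩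
      · rintro ⟨_, _, h, rfl, rfl⟩
        exact h
    have hfresh : Measurable fun ω : ℕ × Fin m → Bool => fun a => ω (t + 1, a) :=
      measurable_pi_lambda _ fun a => measurable_pi_apply _
    rw [hset, measure_biUnion_finset]
    · have hprod : ∀ x : (Fin m → Bool) × (Fin m → Bool),
          N.coins ({ω | N.state ω t = x.1} ∩ {ω | (fun a => ω (t + 1, a)) = x.2})
          = ENNReal.ofReal (N.weight x.1 * N.density t (N.minimalClusters x.1) * N.weight x.2) := by
        intro x
        rw [ENNReal.ofReal_mul (N.weight_nonneg_mul_density _ _), ← ih, ← N.coins_fresh (t + 1)]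
        exact (N.indepFun_state_fresh t).measure_inter_preimage_eq_mul {x.1} {x.2}
          (measurableSet_singleton _) (measurableSet_singleton _)
      simp only [hprod]
      rw [← ENNReal.ofReal_sum_of_nonneg fun x _ => mul_nonneg (N.weight_nonneg_mul_density _ _)
        (N.weight_pos _).le]
      congr 1
      have h := N.sum_density_pop t fun S' => if S' = S then 1 else 0
      simp only [mul_ite, mul_one, mul_zero, Finset.sum_ite_eq', Finset.mem_univ, if_true] at h
      rw [← h, Finset.sum_filter, Fintype.sum_prod_type]
      refine Finset.sum_congr rfl fun S' _ => Finset.sum_congr rfl fun R _ => ?_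
      split_ifs <;> ring
    · rintro x - y - hxy
      refine Set.disjoint_left.2 fun ω hx hy => hxy ?_
      exact Prod.ext (hx.1.symm.trans hy.1) (hx.2.symm.trans hy.2)
    · exact fun x _ => (N.measurable_state t (measurableSet_singleton _)).inter
        (hfresh (measurableSet_singleton _))

theorem lintegral_card_minimalClusters (t : ℕ) :
    ∫⁻ ω, ((N.minimalClusters (N.state ω t)).card : ℝ≥0∞) ∂N.coins
      = ENNReal.ofReal (N.expPopped t) := by
  have h := lintegral_map (μ := N.coins)
    (f := fun S : Fin m → Bool => ((N.minimalClusters S).card : ℝ≥0∞))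
    (measurable_of_countable _) (RootedDigraph.measurable_state (G := N.toRootedDigraph) t)
  rw [← h, lintegral_fintype, expPopped, ENNReal.ofReal_sum_of_nonneg]
  · refine Finset.sum_congr rfl fun S _ => ?_
    rw [Measure.map_apply (RootedDigraph.measurable_state t) (measurableSet_singleton _),
      ← mul_assoc, ENNReal.ofReal_mul (N.weight_nonneg_mul_density _ _), ← N.coins_state,
      ENNReal.ofReal_natCast, mul_comm]
    rfl
  · exact fun S _ => mul_nonneg (N.weight_pos S).le
      (mul_nonneg (N.density_nonneg _ _) (Nat.cast_nonneg _))

/-- The expected number of popped clusters is at most the ratio of the probabilities of exactly one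
minimal cluster and of none. -/
theorem lintegral_poppedClusters_le (hconn : N.IsRootConnected) :
    ∫⁻ ω, N.poppedClusters ω ∂N.coins
      ≤ ENNReal.ofReal (N.oneClusterProb / N.exactProb ∅) := by
  simp only [RootedDigraph.poppedClusters]
  rw [lintegral_tsum]
  · simp only [N.lintegral_card_minimalClusters]
    rw [ENNReal.tsum_eq_iSup_nat]
    refine iSup_le fun k => ?_
    rw [← ENNReal.ofReal_sum_of_nonneg fun t _ => N.expPopped_nonneg t]
    exact ENNReal.ofReal_le_ofReal (N.sum_expPopped_le hconn k)
  · exact fun t => ((measurable_of_countable fun S : Fin m → Bool =>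
      ((N.minimalClusters S).card : ℝ≥0∞)).comp (RootedDigraph.measurable_state t)).aemeasurable

end Network

/-! ### Repairing a subgraph with one minimal cluster -/

namespace RootedDigraph

variable {n m : ℕ} {G : RootedDigraph n m} {S : Fin m → Bool} {rev : Fin m → Fin m}
  {W : Fin n → Prop}

/-- The arc `e` lies inside `W` and joins two different strongly connected components. -/
def Crosses (G : RootedDigraph n m) (S : Fin m → Bool) (W : Fin n → Prop) (e : Fin m) : Prop :=
  W (G.src e) ∧ W (G.tgt e) ∧
    ¬(G.Reach S (G.src e) (G.tgt e) ∧ G.Reach S (G.tgt e) (G.src e))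

open Classical in
/-- The subgraph `S` with all arcs inside `W` between different strongly connected components
reversed. -/
noncomputable def reverse (G : RootedDigraph n m) (rev : Fin m → Fin m) (W : Fin n → Prop)
    (S : Fin m → Bool) : Fin m → Bool :=
  fun e => if G.Crosses S W e then S (rev e) else S e

theorem crosses_rev (hrev : ∀ a, G.src (rev a) = G.tgt a ∧ G.tgt (rev a) = G.src a) (e : Fin m) :
    G.Crosses S W (rev e) ↔ G.Crosses S W e := by
  simp only [Crosses, (hrev e).1, (hrev e).2]
  tauto

/-- Inside a set that `S` does not leave, reversing the arcs between strongly connected components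
reverses reachability. -/
theorem reach_reverse_iff (hrev : ∀ a, G.src (rev a) = G.tgt a ∧ G.tgt (rev a) = G.src a)
    (hinv : Function.Involutive rev) (hW : ∀ a, S a = true → W (G.src a) → W (G.tgt a))
    {x y : Fin n} (hx : W x) :
    G.Reach (G.reverse rev W S) x y ↔ W y ∧ G.Reach S y x := by
  have hWreach : ∀ {x y}, W x → G.Reach S x y → W y := by
    intro x y hx h
    induction h with
    | refl => exact hx
    | tail _ hs ih =>
      obtain ⟨a, ha, rfl, rfl⟩ := hs
      exact hW a ha ih
  have hscc : ∀ {x y}, W x → G.Reach S x y → G.Reach S y x →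
      G.Reach (G.reverse rev W S) x y := by
    intro x y hx h
    induction h using Relation.ReflTransGen.head_induction_on with
    | refl => exact fun _ => Reach.refl _
    | head hs hzy ih =>
      intro hyx
      obtain ⟨a, ha, rfl, rfl⟩ := hs
      have hstep := Reach.of_arc (G := G) ha
      refine Reach.trans (Reach.of_arc (a := a) ?_) (ih (hW a ha hx) (hyx.trans hstep))
      rw [reverse, if_neg fun h => h.2.2 ⟨hstep, Reach.trans hzy hyx⟩, ha]
  constructor
  · intro h
    induction h with
    | refl => exact ⟨hx, Reach.refl _⟩
    | tail _ hs ih =>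
      obtain ⟨a, ha, rfl, rfl⟩ := hs
      by_cases hc : G.Crosses S W a
      · rw [reverse, if_pos hc] at ha
        refine ⟨hc.2.1, Reach.trans ?_ ih.2⟩
        have := Reach.of_arc (G := G) ha
        rwa [(hrev a).1, (hrev a).2] at this
      · rw [reverse, if_neg hc] at ha
        have hWt := hW a ha ih.1
        refine ⟨hWt, Reach.trans ?_ ih.2⟩
        by_contra hn
        exact hc ⟨ih.1, hWt, fun h => hn h.2⟩
  · rintro ⟨hy, h⟩
    induction h using Relation.ReflTransGen.head_induction_on with
    | refl => exact Reach.refl _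
    | head hs hzx ih =>
      obtain ⟨a, ha, rfl, rfl⟩ := hs
      have hWt := hW a ha hy
      refine (ih hWt).trans ?_
      by_cases hc : G.Reach S (G.tgt a) (G.src a)
      · exact hscc hWt hc (Reach.of_arc ha)
      · have hcross : G.Crosses S W (rev a) :=
          (crosses_rev hrev a).2 ⟨hy, hWt, fun h => hc h.2⟩
        have h := Reach.of_arc (G := G) (S := G.reverse rev W S) (a := rev a)
          (by rw [reverse, if_pos hcross, hinv a, ha])
        rwa [(hrev a).1, (hrev a).2] at h

theorem crosses_reverse (hrev : ∀ a, G.src (rev a) = G.tgt a ∧ G.tgt (rev a) = G.src a)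
    (hinv : Function.Involutive rev) (hW : ∀ a, S a = true → W (G.src a) → W (G.tgt a))
    (e : Fin m) : G.Crosses (G.reverse rev W S) W e ↔ G.Crosses S W e := by
  refine and_congr_right fun hs => and_congr_right fun ht => not_congr ?_
  rw [reach_reverse_iff hrev hinv hW hs, reach_reverse_iff hrev hinv hW ht]
  tauto

theorem reverse_reverse (hrev : ∀ a, G.src (rev a) = G.tgt a ∧ G.tgt (rev a) = G.src a)
    (hinv : Function.Involutive rev) (hW : ∀ a, S a = true → W (G.src a) → W (G.tgt a)) :
    G.reverse rev W (G.reverse rev W S) = S := by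
  funext e
  rw [reverse, crosses_reverse hrev hinv hW]
  split_ifs with h
  · rw [reverse, if_pos ((crosses_rev hrev e).2 h), hinv e]
  · rw [reverse, if_neg h]

end RootedDigraph

namespace Network

variable {n m : ℕ} (N : Network n m)

theorem weight_reverse {rev : Fin m → Fin m}
    (hrev : ∀ a, N.src (rev a) = N.tgt a ∧ N.tgt (rev a) = N.src a)
    (hinv : Function.Involutive rev) (hp : ∀ a, N.p (rev a) = N.p a) (W : Fin n → Prop)
    (S : Fin m → Bool) : N.weight (N.reverse rev W S) = N.weight S := by
  classical
  let σ : Fin m → Fin m := fun e => if N.Crosses S W e then rev e else e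
  have hσ : Function.Involutive σ := by
    intro e
    by_cases h : N.Crosses S W e
    · simp only [σ, h, (RootedDigraph.crosses_rev hrev e).2 h, if_true, hinv e]
    · simp only [σ, h, if_false]
  refine Fintype.prod_equiv hσ.toPerm _ _ fun e => ?_
  change _ = if S (σ e) = true then 1 - N.p (σ e) else N.p (σ e)
  by_cases h : N.Crosses S W e
  · simp only [σ, h, RootedDigraph.reverse, if_true, hp]
  · simp only [σ, h, RootedDigraph.reverse, if_false]

theorem weight_update_true {S : Fin m → Bool} {a : Fin m} (ha : S a = false) :
    N.weight S * (1 - N.p a) = N.p a * N.weight (Function.update S a true) := by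
  classical
  rw [weight, weight, ← Finset.mul_prod_erase _ _ (Finset.mem_univ a),
    ← Finset.mul_prod_erase (a := a) _
      (fun b => if Function.update S a true b = true then 1 - N.p b else N.p b) (Finset.mem_univ a)]
  have : ∏ b ∈ Finset.univ.erase a,
      (if Function.update S a true b = true then 1 - N.p b else N.p b)
      = ∏ b ∈ Finset.univ.erase a, if S b = true then 1 - N.p b else N.p b := by
    refine Finset.prod_congr rfl fun b hb => ?_
    rw [Function.update_of_ne (Finset.ne_of_mem_erase hb)]
  rw [this]
  simp only [ha, Function.update_self, if_true, Bool.false_eq_true, if_false]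
  ring

theorem p_le_pMax (a : Fin m) : N.p a ≤ N.pMax :=
  le_ciSup (Set.finite_range N.p).bddAbove a

theorem pMax_lt_one : N.pMax < 1 := by
  rcases isEmpty_or_nonempty (Fin m) with h | h
  · rw [pMax, Real.iSup_of_isEmpty]
    exact zero_lt_one
  · obtain ⟨a, ha⟩ := exists_eq_ciSup_of_finite (f := N.p)
    rw [pMax, ← ha]
    exact N.p_lt_one a

theorem pMax_nonneg : 0 ≤ N.pMax := Real.iSup_nonneg fun a => (N.p_pos a).le

theorem pMax_div_nonneg : 0 ≤ N.pMax / (1 - N.pMax) :=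
  div_nonneg N.pMax_nonneg (sub_nonneg.2 N.pMax_lt_one.le)

/-- A subgraph with exactly one minimal cluster becomes root-connected if one takes an arc `a` from
a vertex `u` that does not reach the root to one that does, adds it, and reverses the arcs between
different strongly connected components among the vertices that `u` reaches. The result, the arc
`a` and a vertex `v` of the minimal cluster determine the subgraph, since without `a` the vertex `v`
reaches exactly what `u` reached before. -/
theorem exists_repair {rev : Fin m → Fin m}
    (hrev : ∀ a, N.src (rev a) = N.tgt a ∧ N.tgt (rev a) = N.src a)
    (hinv : Function.Involutive rev) (hp : ∀ a, N.p (rev a) = N.p a)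
    (hconn : N.IsRootConnected) {S : Fin m → Bool} (hS : (N.minimalClusters S).card = 1) :
    ∃ (S' : Fin m → Bool) (a : Fin m) (v : Fin n), N.minimalClusters S' = ∅ ∧
      N.weight S ≤ N.pMax / (1 - N.pMax) * N.weight S' ∧
      S = N.reverse rev (N.Reach (Function.update S' a false) v) (Function.update S' a false) := by
  obtain ⟨C, hC⟩ := Finset.card_eq_one.1 hS
  have hCmin : N.IsMinimalCluster S C := by
    rw [← RootedDigraph.mem_minimalClusters, hC]
    exact Finset.mem_singleton_self C
  obtain ⟨v, hv⟩ := hCmin.1.1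
  have hreach : ∀ x, ¬ N.Reach S x N.root → N.Reach S x v := by
    intro x hx
    obtain ⟨C', hC', h⟩ := RootedDigraph.exists_minimal_of_not_reach hx
    rw [← RootedDigraph.mem_minimalClusters, hC, Finset.mem_singleton] at hC'
    exact h v (hC' ▸ hv)
  obtain ⟨a, ha, ha'⟩ : ∃ a, ¬ N.Reach S (N.src a) N.root ∧ N.Reach S (N.tgt a) N.root := by
    by_contra! hno
    refine hCmin.1.not_reach_root hv ?_
    refine Relation.ReflTransGen.head_induction_on (hconn v)
      (motive := fun x _ => N.Reach S x N.root) (RootedDigraph.Reach.refl _) ?_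
    rintro x y ⟨a, rfl, rfl⟩ _ hy
    by_contra hx
    exact hno a hx hy
  set W : Fin n → Prop := N.Reach S (N.src a) with hWdef
  have hW : ∀ e, S e = true → W (N.src e) → W (N.tgt e) := fun e he h =>
    RootedDigraph.Reach.trans h (RootedDigraph.Reach.of_arc he)
  have hWroot : ∀ x, W x → ¬ N.Reach S x N.root := fun x hx h =>
    ha (RootedDigraph.Reach.trans hx h)
  have hWv : W v := hreach _ ha
  have hSa : S a = false := by
    by_contra h
    exact ha ((RootedDigraph.Reach.of_arc (by simpa using h)).trans ha')
  set S₁ := N.reverse rev W S with hS₁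
  have hS₁of : ∀ e, ¬ N.Crosses S W e → S₁ e = S e := fun e h => by
    rw [hS₁, RootedDigraph.reverse, if_neg h]
  have hS₁a : S₁ a = false := by
    rw [hS₁of a fun h => hWroot _ h.2.1 ha', hSa]
  have hWv' : N.Reach S₁ v = W := by
    funext y
    rw [eq_iff_iff, hS₁, RootedDigraph.reach_reverse_iff hrev hinv hW hWv]
    exact ⟨fun h => h.1, fun h => ⟨h, hreach y (hWroot y h)⟩⟩
  have hupd : Function.update (Function.update S₁ a true) a false = S₁ := by
    rw [Function.update_idem, ← hS₁a, Function.update_eq_self]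
  have hmono : ∀ e, S₁ e = true → Function.update S₁ a true e = true := by
    intro e he
    by_cases hea : e = a
    · simp [hea]
    · rwa [Function.update_of_ne hea]
  refine ⟨Function.update S₁ a true, a, v, ?_, ?_, ?_⟩
  · rw [RootedDigraph.minimalClusters_eq_empty_iff_reach]
    have hstep : ∀ e, S e = true → ¬ W (N.src e) →
        N.Reach (Function.update S₁ a true) (N.src e) (N.tgt e) := fun e he hWe =>
      RootedDigraph.Reach.of_arc (hmono e ((hS₁of e fun h => hWe h.1).trans he))
    have h1 : ∀ x, N.Reach S x N.root → N.Reach (Function.update S₁ a true) x N.root := by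
      intro x hx
      induction hx using Relation.ReflTransGen.head_induction_on with
      | refl => exact RootedDigraph.Reach.refl _
      | head hs hz ih =>
        obtain ⟨e, he, rfl, rfl⟩ := hs
        exact (hstep e he fun h => hWroot _ h
          ((RootedDigraph.Reach.of_arc he).trans hz)).trans ih
    have h2 : ∀ x, W x → N.Reach (Function.update S₁ a true) x N.root := by
      intro x hx
      have hxa : N.Reach S₁ x (N.src a) :=
        (RootedDigraph.reach_reverse_iff hrev hinv hW hx).2 ⟨RootedDigraph.Reach.refl _, hx⟩
      have hxa' : N.Reach (Function.update S₁ a true) x (N.src a) :=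
        hxa.mono hmono
      exact (hxa'.trans (RootedDigraph.Reach.of_arc (by simp))).trans (h1 _ ha')
    intro x
    by_cases hx : N.Reach S x N.root
    · exact h1 x hx
    have hxv := hreach x hx
    clear hx
    induction hxv using Relation.ReflTransGen.head_induction_on with
    | refl => exact h2 v hWv
    | head hs hz ih =>
      obtain ⟨e, he, rfl, rfl⟩ := hs
      by_cases hWe : W (N.src e)
      · exact h2 _ hWe
      · exact (hstep e he hWe).trans ih
  · have h := N.weight_update_true hS₁a
    rw [hS₁, N.weight_reverse hrev hinv hp, ← hS₁] at h
    have hpa := sub_pos.2 (N.p_lt_one a)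
    have hpm := sub_pos.2 N.pMax_lt_one
    have h' : N.weight S = N.p a / (1 - N.p a) * N.weight (Function.update S₁ a true) := by
      field_simp
      linarith
    rw [h']
    refine mul_le_mul_of_nonneg_right ?_ (N.weight_pos _).le
    have := N.p_le_pMax a
    exact div_le_div₀ N.pMax_nonneg this hpm (by linarith)
  · rw [hupd, hWv', hS₁, RootedDigraph.reverse_reverse hrev hinv hW]

theorem oneClusterProb_le (hbi : N.IsBidirected) (hconn : N.IsRootConnected) :
    N.oneClusterProb ≤ N.pMax / (1 - N.pMax) * m * n * N.exactProb ∅ := by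
  classical
  obtain ⟨rev, hinv, h⟩ := hbi
  have hrep := fun S (hS : (N.minimalClusters S).card = 1) =>
    N.exists_repair (fun a => ⟨(h a).1, (h a).2.1⟩) hinv (fun a => (h a).2.2) hconn hS
  have : Nonempty (Fin n) := ⟨N.root⟩
  rcases isEmpty_or_nonempty (Fin m) with hm | hm
  · have : N.oneClusterProb = 0 := Finset.sum_eq_zero fun S _ => if_neg fun hS => by
      obtain ⟨-, a, -⟩ := hrep S hS
      exact hm.elim a
    rw [this]
    refine mul_nonneg (mul_nonneg (mul_nonneg N.pMax_div_nonneg (Nat.cast_nonneg _))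
      (Nat.cast_nonneg _)) (Finset.sum_nonneg fun S _ => ?_)
    split_ifs
    · exact (N.weight_pos S).le
    · exact le_rfl
  choose! f g k hf hw hdec using hrep
  have hinj : Set.InjOn (fun S => (f S, g S, k S))
      (Finset.univ.filter fun S => (N.minimalClusters S).card = 1 : Finset (Fin m → Bool)) := by
    intro S hS S' hS' he
    simp only [Finset.coe_filter, Finset.mem_univ, true_and, Set.mem_ofPred_eq] at hS hS'
    simp only [Prod.mk.injEq] at he
    rw [hdec S hS, hdec S' hS', he.1, he.2.1, he.2.2]
  calc N.oneClusterProb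
      = ∑ S ∈ Finset.univ.filter fun S => (N.minimalClusters S).card = 1, N.weight S := by
        rw [oneClusterProb, Finset.sum_filter]
    _ ≤ ∑ S ∈ Finset.univ.filter fun S => (N.minimalClusters S).card = 1,
          N.pMax / (1 - N.pMax) * N.weight (f S) :=
        Finset.sum_le_sum fun S hS => hw S (by simpa using hS)
    _ = ∑ x ∈ (Finset.univ.filter fun S => (N.minimalClusters S).card = 1).image
          fun S => (f S, g S, k S), N.pMax / (1 - N.pMax) * N.weight x.1 := by
        rw [Finset.sum_image hinj]
    _ ≤ ∑ x ∈ (Finset.univ.filter fun S => N.minimalClusters S = ∅) ×ˢ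
          (Finset.univ : Finset (Fin m × Fin n)), N.pMax / (1 - N.pMax) * N.weight x.1 := by
        refine Finset.sum_le_sum_of_subset_of_nonneg ?_ fun x _ _ =>
          mul_nonneg N.pMax_div_nonneg (N.weight_pos _).le
        intro x hx
        obtain ⟨S, hS, rfl⟩ := Finset.mem_image.1 hx
        simpa using hf S (by simpa using hS)
    _ = _ := by
        rw [Finset.sum_product, exactProb, ← Finset.sum_filter, Finset.mul_sum]
        refine Finset.sum_congr rfl fun S _ => ?_
        simp
        ring

end Network

/-! ### The bounds -/

namespace Network

variable {n m : ℕ} (N : Network n m)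

theorem lintegral_poppedClusters_le_mul (hbi : N.IsBidirected) (hconn : N.IsRootConnected) :
    ∫⁻ ω, N.poppedClusters ω ∂N.coins
      ≤ ENNReal.ofReal (N.pMax / (1 - N.pMax) * (m : ℝ) * (n : ℝ)) := by
  refine (N.lintegral_poppedClusters_le hconn).trans (ENNReal.ofReal_le_ofReal ?_)
  rw [div_le_iff₀ (N.exactProb_pos hconn (Finset.empty_subset (N.minimalClusters fun _ => true)))]
  exact N.oneClusterProb_le hbi hconn

/-- Every vertex except the root has an outgoing arc. -/
theorem card_vertices_le (hconn : N.IsRootConnected) : n ≤ m + 1 := by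
  classical
  have h : (Finset.univ : Finset (Fin n)) ⊆ insert N.root (Finset.univ.image N.src) := by
    intro v _
    rcases (hconn v).cases_head with h | ⟨w, ⟨a, h, -⟩, -⟩
    · simp [h]
    · simp [← h]
  calc n = (Finset.univ : Finset (Fin n)).card := by simp
    _ ≤ _ := Finset.card_le_card h
    _ ≤ (Finset.univ.image N.src).card + 1 := Finset.card_insert_le _ _
    _ ≤ (Finset.univ : Finset (Fin m)).card + 1 := Nat.add_le_add_right Finset.card_image_le 1
    _ = m + 1 := by simp

theorem lintegral_poppingTime_le (hbi : N.IsBidirected) (hconn : N.IsRootConnected) :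
    ∫⁻ ω, N.poppingTime ω ∂N.coins
      ≤ ENNReal.ofReal (81 * (N.pMax / (1 - N.pMax) * (m : ℝ) ^ 2 * (n : ℝ))) := by
  calc ∫⁻ ω, N.poppingTime ω ∂N.coins
      ≤ ∫⁻ ω, ((27 * (m + n) : ℕ) : ℝ≥0∞) * N.poppedClusters ω ∂N.coins :=
        lintegral_mono fun ω => RootedDigraph.poppingTime_le ω
    _ = ((27 * (m + n) : ℕ) : ℝ≥0∞) * ∫⁻ ω, N.poppedClusters ω ∂N.coins :=
        lintegral_const_mul' _ _ (ENNReal.natCast_ne_top _)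
    _ ≤ ((27 * (m + n) : ℕ) : ℝ≥0∞) *
          ENNReal.ofReal (N.pMax / (1 - N.pMax) * (m : ℝ) * (n : ℝ)) := by
        gcongr
        exact N.lintegral_poppedClusters_le_mul hbi hconn
    _ ≤ _ := by
        rw [← ENNReal.ofReal_natCast, ← ENNReal.ofReal_mul (Nat.cast_nonneg _)]
        refine ENNReal.ofReal_le_ofReal ?_
        -- without arcs both sides vanish; otherwise `n ≤ m + 1 ≤ 2 * m`
        have hmn : ((m : ℝ) + n) * m ≤ 3 * m * m := by
          rcases Nat.eq_zero_or_pos m with rfl | hm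
          · simp
          · have h : (n : ℝ) ≤ 2 * m := by
              have := N.card_vertices_le hconn
              exact_mod_cast (by omega : n ≤ 2 * m)
            exact mul_le_mul_of_nonneg_right (by linarith) (Nat.cast_nonneg m)
        have := mul_le_mul_of_nonneg_left hmn
          (mul_nonneg N.pMax_div_nonneg (Nat.cast_nonneg (α := ℝ) n))
        push_cast
        linarith

theorem lintegral_runningTime_le (hbi : N.IsBidirected) (hconn : N.IsRootConnected) :
    ∫⁻ ω, N.runningTime ω ∂N.coins ≤ ENNReal.ofReal
      (81 * ((m : ℝ) + (n : ℝ) + N.pMax / (1 - N.pMax) * (m : ℝ) ^ 2 * (n : ℝ))) := by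
  calc ∫⁻ ω, N.runningTime ω ∂N.coins
      ≤ ∫⁻ ω, (((24 * (m + n) : ℕ) : ℝ≥0∞) + N.poppingTime ω) ∂N.coins :=
        lintegral_mono fun ω => (RootedDigraph.runningTime_le ω).trans <| by
          gcongr
          exact RootedDigraph.initialTime_le ω
    _ = ((24 * (m + n) : ℕ) : ℝ≥0∞) + ∫⁻ ω, N.poppingTime ω ∂N.coins := by
        rw [lintegral_add_left measurable_const, lintegral_const, measure_univ, mul_one]
    _ ≤ ENNReal.ofReal ((24 * (m + n) : ℕ) : ℝ) +
          ENNReal.ofReal (81 * (N.pMax / (1 - N.pMax) * (m : ℝ) ^ 2 * (n : ℝ))) := by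
        rw [ENNReal.ofReal_natCast]
        gcongr
        exact N.lintegral_poppingTime_le hbi hconn
    _ ≤ _ := by
        have h := N.pMax_div_nonneg
        rw [← ENNReal.ofReal_add (Nat.cast_nonneg _) (by positivity)]
        refine ENNReal.ofReal_le_ofReal ?_
        push_cast
        have hm : (0 : ℝ) ≤ m := Nat.cast_nonneg m
        have hn : (0 : ℝ) ≤ n := Nat.cast_nonneg n
        linarith

end Network

theorem theorem3p2 :
    ∃ c : ℕ, ∀ (n m : ℕ) (N : Network n m), N.IsBidirected → N.IsRootConnected →
      -- the expected number of popped clusters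
      (∫⁻ ω, N.poppedClusters ω ∂N.coins
        ≤ ENNReal.ofReal (N.pMax / (1 - N.pMax) * (m : ℝ) * (n : ℝ))) ∧
      -- the step-counted implementation carries out cluster popping, and it stops exactly when
      -- there is no cluster
      (∀ ω k, (N.run ω k).val.graph = N.state ω k ∧
        ((N.run ω k).val.reps = [] ↔ ¬ ∃ C, N.IsCluster (N.state ω k) C)) ∧
      -- its running time: the part before the loop, the loop, and the total
      (∀ ω, N.initialTime ω ≤ c * (m + n)) ∧
      (∫⁻ ω, N.poppingTime ω ∂N.coins
        ≤ ENNReal.ofReal ((c : ℝ) * (N.pMax / (1 - N.pMax) * (m : ℝ) ^ 2 * (n : ℝ)))) ∧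
      (∫⁻ ω, N.runningTime ω ∂N.coins
        ≤ ENNReal.ofReal ((c : ℝ) *
            ((m : ℝ) + (n : ℝ) + N.pMax / (1 - N.pMax) * (m : ℝ) ^ 2 * (n : ℝ)))) := by
  refine ⟨81, fun n m N hbi hconn => ⟨N.lintegral_poppedClusters_le_mul hbi hconn, fun ω k => ?_,
    fun ω => ?_, ?_, ?_⟩⟩
  · rw [RootedDigraph.run_val]
    exact ⟨rfl, RootedDigraph.detect_reps_eq_nil_iff.trans
      RootedDigraph.minimalClusters_eq_empty_iff⟩
  · exact (RootedDigraph.initialTime_le ω).trans (Nat.mul_le_mul_right _ (by norm_num))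
  · exact_mod_cast N.lintegral_poppingTime_le hbi hconn
  · exact_mod_cast N.lintegral_runningTime_le hbi hconn
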